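/- Let $n\ge 1$, $s>\frac n2+3$, let $u_0\in H^s(\mathbb R^n)$ be real-valued, and let the real-valued coefficient $b$ satisfy $b\in \mathcal C\cap L^\infty\big([0,\infty),H^{s-1}(\mathbb R^n)\big)$. (Elements of $H^s$ and $H^{s-1}$ are identified with their continuous representatives.) Then there exist a time $T_0>0$, depending on $u_0$ and $b$, and a function $u\in \mathcal C\big([0,T_0],H^s(\mathbb R^n)\big)$ which is the unique solution in this space of $$\partial_t u=\Delta u+|\nabla u|^2\,b,\qquad u(0,\cdot)=u_0 .$$ More precisely: $u(t,\cdot)$ is of class $C^2$ for every $t\in[0,T_0]$ and the equation holds at every point of $[0,T_0]\times\mathbb R^n$ (with one-sided time derivatives at $t=0$ and $t=T_0$); $u$ also satisfies the mild formulation $$u(t,\cdot)=h_t*u_0+\int_0^t h_{t-\tau}*\big(|\nabla u(\tau,\cdot)|^2\,b(\tau,\cdot)\big)\,d\tau,\qquad 0<t\le T_0,$$ where $h_t(x)=(4\pi t)^{-n/2}e^{-|x|^2/(4t)}$ is the heat kernel; and every $v\in \mathcal C\big([0,T_0],H^s(\mathbb R^n)\big)$ with $v(0)=u_0$ that solves the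 problem in either of these two senses (classical or mild) equals $u$ on $[0,T_0]$. -/

import Mathlib

open MeasureTheory Set
open scoped SchwartzMap Laplacian Gradient

noncomputable section

/-- The complex-valued `L²` function `x ↦ (f x : ℂ)` of a real-valued `L²` function `f` on `ℝⁿ`. -/
def complexify (n : ℕ) :
    Lp ℝ 2 (volume : Measure (EuclideanSpace ℝ (Fin n))) →ₗ[ℝ]
      Lp ℂ 2 (volume : Measure (EuclideanSpace ℝ (Fin n))) :=
  Complex.ofRealCLM.compLpₗ 2 volume

theorem complexify_injective (n : ℕ) : Function.Injective (complexify n) := by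
  rw [← LinearMap.ker_eq_bot, LinearMap.ker_eq_bot']
  intro f hf
  rw [Lp.eq_zero_iff_ae_eq_zero]
  have h1 := Complex.ofRealCLM.coeFn_compLp f
  have h2 : (complexify n f : EuclideanSpace ℝ (Fin n) → ℂ) =ᵐ[volume] 0 := by
    rw [hf]; exact Lp.coeFn_zero _ _ _
  filter_upwards [h1, h2] with x hx1 hx2
  have : Complex.ofRealCLM (f x) = 0 := hx1.symm.trans hx2
  simpa using this

theorem toTemperedDistribution_injective (n : ℕ) :
    Function.Injective
      (Lp.toTemperedDistributionCLM ℂ (volume : Measure (EuclideanSpace ℝ (Fin n))) 2) :=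
  LinearMap.ker_eq_bot.mp Lp.ker_toTemperedDistributionCLM_eq_bot

/-- The real-valued `f ∈ L²(ℝⁿ)` that lie in `H^s`, i.e. for which the Bessel potential
`𝓕⁻¹ ((1 + |ξ|²)^(s/2) 𝓕 f)` of order `s` is in `L²`. For `s ≥ 0` these are all the
real-valued elements of `H^s(ℝⁿ)`. -/
def sobolevSubmodule (n : ℕ) (s : ℝ) :
    Submodule ℝ (Lp ℝ 2 (volume : Measure (EuclideanSpace ℝ (Fin n)))) where
  carrier := {f | TemperedDistribution.MemSobolev s 2
    (complexify n f : 𝓢'(EuclideanSpace ℝ (Fin n), ℂ))}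
  add_mem' {f g} hf hg := by
    have h := TemperedDistribution.MemSobolev.add hf hg
    simp only [← Lp.toTemperedDistributionCLM_apply, ← map_add] at h
    exact h
  zero_mem' := by
    have h := TemperedDistribution.memSobolev_fun_zero (EuclideanSpace ℝ (Fin n)) ℂ s 2
    simpa only [mem_ofPred_eq, ← Lp.toTemperedDistributionCLM_apply, map_zero] using h
  smul_mem' c f hf := by
    have h := TemperedDistribution.MemSobolev.smul (c : ℂ) hf
    simp only [← Lp.toTemperedDistributionCLM_apply, ← map_smul] at h
    have e : complexify n (c • f) = (c : ℂ) • complexify n f := by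
      rw [map_smul]; exact (Complex.coe_smul c _).symm
    simp only [mem_ofPred_eq, e]
    exact h

/-- The Sobolev space `H^s(ℝⁿ)` of real-valued functions (`s ≥ 0`). It is a type of its own, so
that it carries the `H^s` norm below and not the `L²` norm. -/
def HSob (n : ℕ) (s : ℝ) : Type := sobolevSubmodule n s

namespace HSob

variable {n : ℕ} {s : ℝ}

instance : AddCommGroup (HSob n s) := inferInstanceAs (AddCommGroup (sobolevSubmodule n s))

instance : Module ℝ (HSob n s) := inferInstanceAs (Module ℝ (sobolevSubmodule n s))

/-- The inclusion `H^s(ℝⁿ) ⊆ L²(ℝⁿ)`. -/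
def toL2 : HSob n s →ₗ[ℝ] Lp ℝ 2 (volume : Measure (EuclideanSpace ℝ (Fin n))) :=
  (sobolevSubmodule n s).subtype

theorem toL2_injective : Function.Injective (toL2 : HSob n s →ₗ[ℝ] _) := Subtype.val_injective

theorem memSobolev (f : HSob n s) : TemperedDistribution.MemSobolev s 2
    (complexify n (toL2 f) : 𝓢'(EuclideanSpace ℝ (Fin n), ℂ)) := f.2

/-- The `L²` function that represents the Bessel potential of order `s` of `f`. -/
def besselFun (f : HSob n s) : Lp ℂ 2 (volume : Measure (EuclideanSpace ℝ (Fin n))) :=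
  (memSobolev f).choose

theorem besselFun_spec (f : HSob n s) :
    TemperedDistribution.besselPotential (EuclideanSpace ℝ (Fin n)) ℂ s
      (Lp.toTemperedDistributionCLM ℂ volume 2 (complexify n (toL2 f))) =
      Lp.toTemperedDistributionCLM ℂ volume 2 (besselFun f) := (memSobolev f).choose_spec

/-- The Bessel potential as a linear map `H^s → L²`. -/
def bessel : HSob n s →ₗ[ℝ] Lp ℂ 2 (volume : Measure (EuclideanSpace ℝ (Fin n))) where
  toFun := besselFun
  map_add' f g := by
    apply toTemperedDistribution_injective n
    rw [map_add, ← besselFun_spec, ← besselFun_spec, ← besselFun_spec]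
    simp only [map_add]
  map_smul' c f := by
    apply toTemperedDistribution_injective n
    have e : complexify n (toL2 (c • f)) = (c : ℂ) • complexify n (toL2 f) := by
      rw [map_smul, map_smul]; exact (Complex.coe_smul c _).symm
    have e' : (RingHom.id ℝ) c • besselFun f = (c : ℂ) • besselFun f :=
      (Complex.coe_smul c _).symm
    rw [e', map_smul, ← besselFun_spec, ← besselFun_spec, e]
    simp only [map_smul]

theorem bessel_injective : Function.Injective (bessel : HSob n s →ₗ[ℝ] _) := by
  intro f g h
  have h1 := besselFun_spec f
  have h2 := besselFun_spec g
  have h3 : besselFun f = besselFun g := h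
  rw [h3, ← h2] at h1
  have h4 := congrArg
    (TemperedDistribution.besselPotential (EuclideanSpace ℝ (Fin n)) ℂ (-s)) h1
  simp only [TemperedDistribution.besselPotential_besselPotential_apply, add_neg_cancel,
    TemperedDistribution.besselPotential_zero, ContinuousLinearMap.id_apply] at h4
  exact toL2_injective (complexify_injective n (toTemperedDistribution_injective n h4))

/-- The `H^s` norm `‖f‖ = ‖𝓕⁻¹ ((1 + |ξ|²)^(s/2) 𝓕 f)‖_{L²}`. -/
instance : NormedAddCommGroup (HSob n s) :=
  NormedAddCommGroup.induced _ _ (bessel : HSob n s →ₗ[ℝ] _) bessel_injective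

instance : NormedSpace ℝ (HSob n s) :=
  NormedSpace.induced ℝ _ _ (bessel : HSob n s →ₗ[ℝ] _)

theorem norm_def (f : HSob n s) : ‖f‖ = ‖bessel f‖ := rfl

open Classical in
/-- The values of `f ∈ H^s(ℝⁿ)`: those of its continuous representative, which exists for
`s > n/2` by the Sobolev embedding (and those of some representative if there is no
continuous one). -/
def rep (f : HSob n s) : EuclideanSpace ℝ (Fin n) → ℝ :=
  if h : ∃ g : EuclideanSpace ℝ (Fin n) → ℝ, Continuous g ∧ toL2 f =ᵐ[volume] g then h.choose
  else toL2 f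

/-- The continuous representative is unique, so `rep` involves no arbitrary choice. -/
theorem rep_eq (f : HSob n s) (g : EuclideanSpace ℝ (Fin n) → ℝ) (hg : Continuous g)
    (hfg : toL2 f =ᵐ[volume] g) : rep f = g := by
  have h : ∃ g : EuclideanSpace ℝ (Fin n) → ℝ, Continuous g ∧ toL2 f =ᵐ[volume] g :=
    ⟨g, hg, hfg⟩
  rw [rep, dif_pos h]
  exact (Continuous.ae_eq_iff_eq volume h.choose_spec.1 hg).mp
    (h.choose_spec.2.symm.trans hfg)

end HSob

/-- The heat kernel `h_t(z) = (4πt)^(-n/2) exp (-|z|²/(4t))` on `ℝⁿ`, for `t > 0`. -/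
def heatKernel (n : ℕ) (t : ℝ) (z : EuclideanSpace ℝ (Fin n)) : ℝ :=
  (4 * Real.pi * t) ^ (-(n : ℝ) / 2) * Real.exp (-‖z‖ ^ 2 / (4 * t))

/-- The convolution `(h_t * f)(x)`, for `t > 0`. -/
def heatConv (n : ℕ) (t : ℝ) (f : EuclideanSpace ℝ (Fin n) → ℝ)
    (x : EuclideanSpace ℝ (Fin n)) : ℝ :=
  ∫ y, heatKernel n t (x - y) * f y

/-- The nonlinear term `|∇u|² b` at one time, as a function of `x`. -/
def nonlinearTerm {n : ℕ} {s r : ℝ} (u : HSob n s) (b : HSob n r)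
    (x : EuclideanSpace ℝ (Fin n)) : ℝ :=
  ‖∇ u.rep x‖ ^ 2 * b.rep x

/-- `u` is a classical solution on `[0,T] × ℝⁿ` of `∂ₜu = Δu + |∇u|² b`, `u(0) = u₀`: each
`u(t)` is of class `C²`, and the equation holds at every point (the time derivative being
one-sided at the two ends of `[0,T]`). -/
structure IsClassicalSolution {n : ℕ} {s r : ℝ} (b : ℝ → HSob n r) (u₀ : HSob n s) (T : ℝ)
    (u : ℝ → HSob n s) : Prop where
  init : u 0 = u₀
  contDiff : ∀ t ∈ Icc 0 T, ContDiff ℝ 2 (u t).rep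
  eqn : ∀ t ∈ Icc 0 T, ∀ x, HasDerivWithinAt (fun τ => (u τ).rep x)
    (Δ (u t).rep x + nonlinearTerm (u t) (b t) x) (Icc 0 T) t

/-- `u` is a mild solution on `[0,T] × ℝⁿ` of the same problem: `u(0) = u₀` and, for
`0 < t ≤ T`, `u(t) = h_t * u₀ + ∫₀ᵗ h_{t-τ} * (|∇u(τ)|² b(τ)) dτ`, all integrals being
absolutely convergent. -/
structure IsMildSolution {n : ℕ} {s r : ℝ} (b : ℝ → HSob n r) (u₀ : HSob n s) (T : ℝ)
    (u : ℝ → HSob n s) : Prop where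
  init : u 0 = u₀
  integrable_init : ∀ t ∈ Ioc 0 T, ∀ x, Integrable fun y => heatKernel n t (x - y) * u₀.rep y
  integrable_space : ∀ t ∈ Ioc 0 T, ∀ τ ∈ Ico 0 t, ∀ x,
    Integrable fun y => heatKernel n (t - τ) (x - y) * nonlinearTerm (u τ) (b τ) y
  integrable_time : ∀ t ∈ Ioc 0 T, ∀ x,
    IntervalIntegrable (fun τ => heatConv n (t - τ) (nonlinearTerm (u τ) (b τ)) x) volume 0 t
  eqn : ∀ t ∈ Ioc 0 T, ∀ x, (u t).rep x = heatConv n t u₀.rep x +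
    ∫ τ in (0 : ℝ)..t, heatConv n (t - τ) (nonlinearTerm (u τ) (b τ)) x

end

/-! The argument is carried out on the Fourier side. An element of `H^s` is encoded isometrically by
its symbol `F = (1 + |ξ|²)^(s/2) 𝓕 f` in `L²`, and `synth s F` recovers its pointwise values.
Derivatives, the heat flow and changes of Sobolev order become multiplication operators `mulOp`.
Evaluation at a point is a continuous functional of the symbol when `s > n/2`, so operator
identities in `L²` and pointwise identities can be exchanged (`exists_synth_clm`,
`synth_injective`).

Existence is a contraction argument for the mild equation. The nonlinearity costs one derivative,
but `H^(s-1)` is an algebra (`exists_synth_eq_mul`), so `|∇u|² b` is a bounded expression, quadratic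
in `u`, with values in `H^(s-1)`. The heat flow regains the lost derivative at the price of a factor
`1 + t^(-1/2)`, whose integral over `[0,T]` tends to zero with `T` (`norm_duhamel_le_of_le`). Hence
the Duhamel map contracts a ball of `C([0,T], H^s)` for small `T` (`exists_mild`). Real-valuedness
is a closed condition preserved by the map. Uniqueness of mild solutions, without restriction to a
ball, follows from a Gronwall inequality with the same integrable singularity (`mild_unique`).

It remains to identify classical and mild solutions in `C([0,T], H^s)`. Both are compared with the
differential equation integrated in time in `H^(s-2)`, an order at which point values still make
sense. Classical solutions satisfy it by the fundamental theorem of calculus at each point `x`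
(`isClassicalSolution_iff`). Its equivalence with Duhamel's formula (`mild_iff_integrated`) is
proved after cutting frequencies off at radius `R`: the generator becomes bounded, the flow runs in
both time directions, and the claim reduces to linear ODE theory. Letting `R` vary recovers the
whole symbol. -/

noncomputable section

open Filter Topology
open scoped ENNReal FourierTransform
open Module (finrank)

set_option linter.unusedSectionVars false

/-! ### Bounded Fourier multipliers as operators on `L²`. -/

section Multiplier

variable {E : Type*} [MeasureSpace E]

open Classical in
/-- The operator on `L²` of multiplication by an essentially bounded function `m`
(and `0` if `m` is not essentially bounded). -/
def mulOp (m : E → ℂ) : Lp ℂ 2 (volume : Measure E) →L[ℂ] Lp ℂ 2 (volume : Measure E) :=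
  if h : MemLp m ∞ volume then
    (ContinuousLinearMap.mul ℂ ℂ).holderL volume ∞ 2 2 h.toLp else 0

variable {m m₁ m₂ : E → ℂ}

theorem coeFn_mulOp (h : MemLp m ∞ volume) (F : Lp ℂ 2 (volume : Measure E)) :
    mulOp m F =ᵐ[volume] fun ξ ↦ m ξ * F ξ := by
  rw [mulOp, dif_pos h]
  have h1 := (ContinuousLinearMap.mul ℂ ℂ).coeFn_holder (r := 2) h.toLp F
  filter_upwards [h1, h.coeFn_toLp] with ξ h2 h3
  rw [← h3]
  exact h2

theorem mulOp_apply_eq_iff (h : MemLp m ∞ volume) (F G : Lp ℂ 2 (volume : Measure E)) :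
    mulOp m F = G ↔ (fun ξ ↦ m ξ * F ξ) =ᵐ[volume] G := by
  rw [Lp.ext_iff]
  exact ⟨fun H ↦ (coeFn_mulOp h F).symm.trans H, fun H ↦ (coeFn_mulOp h F).trans H⟩

theorem norm_mulOp_apply_le (h : AEStronglyMeasurable m volume) {C : ℝ} (hC : ∀ ξ, ‖m ξ‖ ≤ C)
    (F : Lp ℂ 2 (volume : Measure E)) : ‖mulOp m F‖ ≤ C * ‖F‖ := by
  have hm : MemLp m ∞ volume := memLp_top_of_bound h C (.of_forall hC)
  apply Lp.norm_le_mul_norm_of_ae_le_mul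
  filter_upwards [coeFn_mulOp hm F] with ξ hξ
  rw [hξ, norm_mul]
  gcongr
  exact hC ξ

theorem norm_mulOp_le (h : AEStronglyMeasurable m volume) {C : ℝ} (hC₀ : 0 ≤ C)
    (hC : ∀ ξ, ‖m ξ‖ ≤ C) : ‖mulOp m‖ ≤ C :=
  ContinuousLinearMap.opNorm_le_bound _ hC₀ (norm_mulOp_apply_le h hC)

theorem mulOp_mulOp (h₁ : MemLp m₁ ∞ volume) (h₂ : MemLp m₂ ∞ volume)
    {h : E → ℂ} (hh : ∀ ξ, m₁ ξ * m₂ ξ = h ξ) (F : Lp ℂ 2 (volume : Measure E)) :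
    mulOp m₁ (mulOp m₂ F) = mulOp h F := by
  have h12 : MemLp h ∞ volume := by
    convert MemLp.mul (r := ∞) h₂ h₁ using 1
    ext ξ; exact (hh ξ).symm
  rw [mulOp_apply_eq_iff h₁]
  filter_upwards [coeFn_mulOp h₂ F, coeFn_mulOp h12 F] with ξ e1 e2
  rw [e1, e2, ← hh, mul_assoc]

theorem mulOp_sub (h₁ : MemLp m₁ ∞ volume) (h₂ : MemLp m₂ ∞ volume) :
    mulOp (fun ξ ↦ m₁ ξ - m₂ ξ) = mulOp m₁ - mulOp m₂ := by
  ext1 F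
  refine (mulOp_apply_eq_iff (h₁.sub h₂) _ _).2 ?_
  filter_upwards [coeFn_mulOp h₁ F, coeFn_mulOp h₂ F,
    Lp.coeFn_sub (mulOp m₁ F) (mulOp m₂ F)] with ξ e1 e2 e3
  rw [sub_apply, e3, Pi.sub_apply, Pi.sub_apply, e1, e2, sub_mul]

theorem mulOp_const_mul (h : MemLp m ∞ volume) (c : ℂ) :
    mulOp (fun ξ ↦ c * m ξ) = c • mulOp m := by
  ext1 F
  rw [mulOp_apply_eq_iff (h.const_mul c)]
  filter_upwards [coeFn_mulOp h F, Lp.coeFn_smul c (mulOp m F)] with ξ e1 e2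
  rw [smul_apply, e2, Pi.smul_apply, e1, smul_eq_mul, mul_assoc]

theorem mulOp_one : mulOp (fun _ : E ↦ (1 : ℂ)) = ContinuousLinearMap.id ℂ _ := by
  ext1 F
  rw [mulOp_apply_eq_iff (memLp_top_const 1)]
  simp

/-- Strong continuity of multiplication operators: bounded pointwise convergence of the symbols. -/
theorem tendsto_mulOp_apply {ι : Type*} {l : Filter ι} [l.IsCountablyGenerated]
    {m : ι → E → ℂ} {m' : E → ℂ} {C : ℝ} (hm : ∀ᶠ i in l, AEStronglyMeasurable (m i) volume)
    (hm' : AEStronglyMeasurable m' volume)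
    (hC : ∀ᶠ i in l, ∀ ξ, ‖m i ξ‖ ≤ C) (hC' : ∀ ξ, ‖m' ξ‖ ≤ C)
    (hlim : ∀ ξ, Tendsto (fun i ↦ m i ξ) l (𝓝 (m' ξ)))
    {F : ι → Lp ℂ 2 (volume : Measure E)} {F' : Lp ℂ 2 (volume : Measure E)}
    (hF : Tendsto F l (𝓝 F')) :
    Tendsto (fun i ↦ mulOp (m i) (F i)) l (𝓝 (mulOp m' F')) := by
  have key : Tendsto (fun i ↦ mulOp (m i) F') l (𝓝 (mulOp m' F')) := by
    have hb' : MemLp m' ∞ volume := memLp_top_of_bound hm' C (.of_forall hC')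
    rw [Lp.tendsto_Lp_iff_tendsto_eLpNorm']
    have e : ∀ᶠ i in l, eLpNorm (⇑(mulOp (m i) F') - ⇑(mulOp m' F')) 2 volume =
        (∫⁻ ξ, ‖(m i ξ - m' ξ) * F' ξ‖ₑ ^ 2) ^ ((1 : ℝ) / 2) := by
      filter_upwards [hm, hC] with i h1 h2
      rw [eLpNorm_eq_lintegral_rpow_enorm_toReal (by norm_num) (by norm_num)]
      simp only [ENNReal.toReal_ofNat]
      congr 1
      apply lintegral_congr_ae
      have hb : MemLp (m i) ∞ volume := memLp_top_of_bound h1 C (.of_forall h2)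
      filter_upwards [coeFn_mulOp hb F', coeFn_mulOp hb' F'] with ξ e1 e2
      rw [Pi.sub_apply, e1, e2, ← sub_mul]
      norm_cast
    rw [tendsto_congr' e]
    have : Tendsto (fun i ↦ ∫⁻ ξ, ‖(m i ξ - m' ξ) * F' ξ‖ₑ ^ 2) l (𝓝 (∫⁻ ξ : E, 0)) := by
      refine tendsto_lintegral_filter_of_dominated_convergence'
        (fun ξ ↦ (ENNReal.ofReal (2 * C) * ‖F' ξ‖ₑ) ^ 2) ?_ ?_ ?_ ?_
      · filter_upwards [hm] with i h1
        exact ((h1.sub hm').mul (Lp.aestronglyMeasurable F')).enorm.pow_const _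
      · filter_upwards [hC] with i h2
        refine .of_forall fun ξ ↦ ?_
        rw [enorm_mul]
        gcongr
        rw [← ofReal_norm]
        apply ENNReal.ofReal_le_ofReal
        calc _ ≤ ‖m i ξ‖ + ‖m' ξ‖ := norm_sub_le _ _
          _ ≤ _ := by linarith [h2 ξ, hC' ξ]
      · simp_rw [mul_pow]
        rw [lintegral_const_mul'' _ ((Lp.aestronglyMeasurable F').enorm.pow_const _)]
        refine ENNReal.mul_ne_top (by finiteness) ?_
        have := (Lp.memLp F').eLpNorm_lt_top
        rw [eLpNorm_lt_top_iff_lintegral_rpow_enorm_lt_top (by norm_num) (by norm_num)] at this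
        simpa using this.ne
      · refine .of_forall fun ξ ↦ ?_
        have h0 : Tendsto (fun i ↦ (m i ξ - m' ξ) * F' ξ) l (𝓝 ((m' ξ - m' ξ) * F' ξ)) :=
          ((hlim ξ).sub_const _).mul_const _
        have h1 := (ENNReal.continuous_pow 2).tendsto _ |>.comp (h0.enorm)
        simpa [Function.comp_def] using h1
    rw [lintegral_zero] at this
    have h2 := (ENNReal.continuous_rpow_const (y := (1 : ℝ) / 2)).tendsto 0 |>.comp this
    simpa [Function.comp_def] using h2
  -- The uniform bound on the symbols absorbs the variation of the argument; `key` treats the fixed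
  -- argument `F'`.
  have h3 : Tendsto (fun i ↦ mulOp (m i) (F i - F')) l (𝓝 0) := by
    apply squeeze_zero_norm' (a := fun i ↦ C * ‖F i - F'‖)
    · filter_upwards [hm, hC] with i h1 h2
      exact norm_mulOp_apply_le h1 h2 _
    · have : Tendsto (fun i ↦ C * ‖F i - F'‖) l (𝓝 (C * ‖F' - F'‖)) :=
        ((hF.sub_const _).norm).const_mul _
      simpa using this
  simpa using h3.add key

end Multiplier

/-! ### The Sobolev weights. -/

section Bracket

variable {E : Type*} [NormedAddCommGroup E] {r r' : ℝ} {ξ : E}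

/-- The weight `(1 + |ξ|²)^(r/2)`. -/
def bracket (r : ℝ) (ξ : E) : ℝ := (1 + ‖ξ‖ ^ 2) ^ (r / 2)

theorem bracket_pos (r : ℝ) (ξ : E) : 0 < bracket r ξ := by unfold bracket; positivity

theorem bracket_ne_zero (r : ℝ) (ξ : E) : (bracket r ξ : ℂ) ≠ 0 :=
  Complex.ofReal_ne_zero.2 (bracket_pos r ξ).ne'

theorem bracket_add (r r' : ℝ) (ξ : E) : bracket (r + r') ξ = bracket r ξ * bracket r' ξ := by
  unfold bracket
  rw [add_div, Real.rpow_add (by positivity)]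

theorem bracket_zero (ξ : E) : bracket 0 ξ = 1 := by simp [bracket]

theorem bracket_two (ξ : E) : bracket 2 ξ = 1 + ‖ξ‖ ^ 2 := by simp [bracket]

theorem bracket_mul_bracket_neg (r : ℝ) (ξ : E) : bracket r ξ * bracket (-r) ξ = 1 := by
  rw [← bracket_add, add_neg_cancel, bracket_zero]

theorem bracket_le_one (hr : r ≤ 0) (ξ : E) : bracket r ξ ≤ 1 :=
  Real.rpow_le_one_of_one_le_of_nonpos (by nlinarith [sq_nonneg ‖ξ‖]) (by linarith)

theorem norm_le_bracket_one (ξ : E) : ‖ξ‖ ≤ bracket 1 ξ := by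
  have h : bracket 1 ξ * bracket 1 ξ = 1 + ‖ξ‖ ^ 2 := by
    rw [← bracket_add, ← bracket_two]; norm_num
  nlinarith [bracket_pos 1 ξ, norm_nonneg ξ]

theorem norm_mul_bracket_le_one (ξ : E) : ‖ξ‖ * bracket (-1) ξ ≤ 1 := by
  calc ‖ξ‖ * bracket (-1) ξ ≤ bracket 1 ξ * bracket (-1) ξ :=
        mul_le_mul_of_nonneg_right (norm_le_bracket_one ξ) (bracket_pos _ _).le
    _ = 1 := bracket_mul_bracket_neg 1 ξ

theorem bracket_one_le (ξ : E) : bracket 1 ξ ≤ 1 + ‖ξ‖ := by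
  have h : bracket 1 ξ * bracket 1 ξ = 1 + ‖ξ‖ ^ 2 := by
    rw [← bracket_add, ← bracket_two]; norm_num
  nlinarith [bracket_pos 1 ξ, norm_nonneg ξ]

theorem continuous_bracket (r : ℝ) : Continuous (bracket r : E → ℝ) := by
  unfold bracket
  refine Continuous.rpow_const (by fun_prop) fun ξ ↦ Or.inl ?_
  positivity

@[fun_prop]
theorem continuous_ofReal_bracket (r : ℝ) : Continuous (fun ξ : E ↦ (bracket r ξ : ℂ)) :=
  Complex.continuous_ofReal.comp (continuous_bracket r)

theorem norm_ofReal_bracket (r : ℝ) (ξ : E) : ‖(bracket r ξ : ℂ)‖ = bracket r ξ := by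
  rw [Complex.norm_real, Real.norm_of_nonneg (bracket_pos r ξ).le]

/-- Peetre-type inequality. -/
theorem bracket_add_le (hr : 0 ≤ r) (ξ η : E) :
    bracket r (ξ + η) ≤ 2 ^ r * (bracket r ξ + bracket r η) := by
  have key : ∀ a b : E, ‖a‖ ≤ ‖b‖ → bracket r (a + b) ≤ 2 ^ r * bracket r b := by
    intro a b hab
    have h2 : (2 : ℝ) ^ r = (4 : ℝ) ^ (r / 2) := by
      rw [show (4 : ℝ) = 2 ^ (2 : ℝ) by norm_num, ← Real.rpow_mul (by norm_num)]
      ring_nf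
    unfold bracket
    rw [h2, ← Real.mul_rpow (by norm_num) (by positivity)]
    apply Real.rpow_le_rpow (by positivity) _ (by linarith)
    have h3 : ‖a + b‖ ≤ 2 * ‖b‖ := (norm_add_le a b).trans (by linarith)
    nlinarith [norm_nonneg (a + b), norm_nonneg b]
  have hpos : (0 : ℝ) < 2 ^ r := by positivity
  rcases le_total ‖ξ‖ ‖η‖ with h | h
  · exact (key ξ η h).trans (by nlinarith [bracket_pos r ξ])
  · rw [add_comm ξ η]
    exact (key η ξ h).trans (by nlinarith [bracket_pos r η])

end Bracket

/-! ### From symbols to continuous functions. -/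

section Synthesis

variable {E : Type*} [NormedAddCommGroup E] [InnerProductSpace ℝ E] [FiniteDimensional ℝ E]
  [MeasurableSpace E] [BorelSpace E] {r : ℝ}

theorem memLp_top_of_continuous_of_le {m : E → ℂ} (hm : Continuous m) {C : ℝ}
    (hC : ∀ ξ, ‖m ξ‖ ≤ C) : MemLp m ∞ (volume : Measure E) :=
  memLp_top_of_bound hm.aestronglyMeasurable C (.of_forall hC)

theorem memLp_top_bracket (hr : r ≤ 0) : MemLp (fun ξ : E ↦ (bracket r ξ : ℂ)) ∞ volume :=
  memLp_top_of_continuous_of_le (by fun_prop) (C := 1) fun ξ ↦ by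
    rw [norm_ofReal_bracket]; exact bracket_le_one hr ξ

theorem integrable_bracket (hr : (finrank ℝ E : ℝ) < r) :
    Integrable (fun ξ : E ↦ bracket (-r) ξ) volume :=
  integrable_rpow_neg_one_add_norm_sq hr

theorem memLp_two_bracket (hr : (finrank ℝ E : ℝ) < 2 * r) :
    MemLp (fun ξ : E ↦ (bracket (-r) ξ : ℂ)) 2 volume := by
  rw [memLp_two_iff_integrable_sq_norm (continuous_ofReal_bracket _).aestronglyMeasurable]
  convert integrable_bracket (E := E) (r := 2 * r) hr using 2 with ξ
  rw [norm_ofReal_bracket, sq, ← bracket_add]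
  ring_nf

theorem integrable_bracket_mul (hr : (finrank ℝ E : ℝ) < 2 * r)
    (F : Lp ℂ 2 (volume : Measure E)) :
    Integrable (fun ξ ↦ (bracket (-r) ξ : ℂ) * F ξ) volume :=
  (memLp_two_bracket hr).integrable_mul (Lp.memLp F)

/-- The function `f` with Fourier transform `(1 + |ξ|²)^(-r/2) F`, when this is integrable. -/
def synth (r : ℝ) (F : Lp ℂ 2 (volume : Measure E)) : E → ℂ :=
  𝓕⁻ (fun ξ ↦ (bracket (-r) ξ : ℂ) * F ξ)

theorem synth_apply (r : ℝ) (F : Lp ℂ 2 (volume : Measure E)) (x : E) :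
    synth r F x = ∫ ξ, (Real.fourierChar (inner ℝ ξ x) : ℂ) * ((bracket (-r) ξ : ℂ) * F ξ) := by
  rw [synth, Real.fourierInv_eq]
  simp [Circle.smul_def]

theorem synth_congr {r r' : ℝ} {F G : Lp ℂ 2 (volume : Measure E)}
    (h : (fun ξ ↦ (bracket (-r) ξ : ℂ) * F ξ) =ᵐ[volume] fun ξ ↦ (bracket (-r') ξ : ℂ) * G ξ) :
    synth r F = synth r' G := by
  ext x
  exact Real.fourierInv_congr_ae h x

/-- Changing the order of the representation. -/
theorem synth_mulOp {r r' : ℝ} {m₁ m₂ : E → ℂ} (h₁ : MemLp m₁ ∞ volume) (h₂ : MemLp m₂ ∞ volume)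
    (h : ∀ ξ, (bracket (-r) ξ : ℂ) * m₁ ξ = (bracket (-r') ξ : ℂ) * m₂ ξ)
    (F : Lp ℂ 2 (volume : Measure E)) :
    synth r (mulOp m₁ F) = synth r' (mulOp m₂ F) := by
  apply synth_congr
  filter_upwards [coeFn_mulOp h₁ F, coeFn_mulOp h₂ F] with ξ e1 e2
  rw [e1, e2, ← mul_assoc, h, mul_assoc]

theorem synth_mulOp_eq_synth {r r' : ℝ} {m : E → ℂ} (hm : MemLp m ∞ volume)
    (h : ∀ ξ, (bracket (-r) ξ : ℂ) * m ξ = (bracket (-r') ξ : ℂ))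
    (F : Lp ℂ 2 (volume : Measure E)) : synth r (mulOp m F) = synth r' F := by
  rw [synth_mulOp hm (memLp_top_const 1) (r' := r') (by simpa using h), mulOp_one,
    ContinuousLinearMap.id_apply]

theorem continuous_fourierInv {f : E → ℂ} (hf : Integrable f) : Continuous (𝓕⁻ f) :=
  VectorFourier.fourierIntegral_continuous Real.continuous_fourierChar
    (continuous_inner.neg) hf

theorem continuous_synth (hr : (finrank ℝ E : ℝ) < 2 * r) (F : Lp ℂ 2 (volume : Measure E)) :
    Continuous (synth r F) := continuous_fourierInv (integrable_bracket_mul hr F)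

theorem exists_norm_synth_le (r : ℝ) (F : Lp ℂ 2 (volume : Measure E)) : ∃ C, ∀ x, ‖synth r F x‖ ≤ C :=
  ⟨_, fun x ↦ VectorFourier.norm_fourierIntegral_le_integral_norm _ _ _ _ x⟩

/-- Evaluation of `synth r F` at a point, as a functional of `F`. -/
theorem exists_synth_clm (hr : (finrank ℝ E : ℝ) < 2 * r) (x : E) :
    ∃ L : Lp ℂ 2 (volume : Measure E) →L[ℂ] ℂ, ∀ F, L F = synth r F x := by
  -- The Riesz representative of evaluation at `x`. The phase is negated because the inner product
  -- is conjugate-linear in its first argument; the weight is in `L²` because `2r` exceeds the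
  -- dimension.
  have hk : MemLp (fun ξ : E ↦ (Real.fourierChar (-inner ℝ ξ x) : ℂ) * (bracket (-r) ξ : ℂ)) 2
      volume := by
    refine (memLp_two_bracket hr).of_le ?_ (.of_forall fun ξ ↦ by
      rw [norm_mul, Circle.norm_coe, one_mul])
    apply Continuous.aestronglyMeasurable
    have : Continuous fun ξ : E ↦ (Real.fourierChar (-inner ℝ ξ x) : ℂ) :=
      continuous_subtype_val.comp (Real.continuous_fourierChar.comp (by fun_prop))
    fun_prop
  refine ⟨innerSL ℂ hk.toLp, fun F ↦ ?_⟩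
  rw [innerSL_apply_apply, L2.inner_def, synth_apply]
  apply integral_congr_ae
  filter_upwards [hk.coeFn_toLp] with ξ hξ
  rw [hξ]
  simp only [RCLike.inner_apply, map_mul, Complex.conj_ofReal]
  rw [AddChar.map_neg_eq_inv, Circle.coe_inv_eq_conj, Complex.conj_conj]
  ring

/-- Fubini, the kernel of the inverse transform being symmetric in its two variables. -/
theorem integral_fourierInv_mul {f g : E → ℂ} (hf : Integrable f) (hg : Integrable g) :
    ∫ x, 𝓕⁻ f x * g x = ∫ ξ, f ξ * 𝓕⁻ g ξ := by
  have h := VectorFourier.integral_fourierIntegral_smul_eq_flip (L := -innerₗ E)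
    Real.continuous_fourierChar (continuous_inner.neg) hf hg
  simp only [smul_eq_mul] at h
  have hL : (-innerₗ E : E →ₗ[ℝ] E →ₗ[ℝ] ℝ).flip = -innerₗ E := by
    ext a b
    simp [real_inner_comm]
  rw [hL] at h
  exact h

/-- The `L²` inverse Fourier transform is given by the integral. -/
theorem coeFn_fourierInv_mulOp_bracket (hr : (finrank ℝ E : ℝ) < 2 * r)
    (F : Lp ℂ 2 (volume : Measure E)) :
    ((𝓕⁻ (mulOp (fun ξ ↦ (bracket (-r) ξ : ℂ)) F) : Lp ℂ 2 (volume : Measure E)) : E → ℂ)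
      =ᵐ[volume] synth r F := by
  have hr0 : 0 ≤ r := by
    have : (0 : ℝ) ≤ finrank ℝ E := by positivity
    linarith
  have hb : MemLp (fun ξ : E ↦ (bracket (-r) ξ : ℂ)) ∞ volume := memLp_top_bracket (by linarith)
  set G := mulOp (fun ξ : E ↦ (bracket (-r) ξ : ℂ)) F
  have hG : G =ᵐ[volume] fun ξ ↦ (bracket (-r) ξ : ℂ) * F ξ := coeFn_mulOp hb F
  -- Both sides are tested against smooth compactly supported functions: the `L²` transform moves
  -- onto the test function by its distributional definition, the integral one by Fubini.
  apply ae_eq_of_integral_contDiff_smul_eq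
  · exact ((Lp.memLp _).locallyIntegrable (by norm_num))
  · exact (continuous_synth hr F).locallyIntegrable
  intro g hg hgc
  have hg' : ContDiff ℝ (↑(⊤ : ℕ∞)) (fun x ↦ (g x : ℂ)) := Complex.ofRealCLM.contDiff.comp hg
  have hgc' : HasCompactSupport (fun x ↦ (g x : ℂ)) := hgc.comp_left (g := Complex.ofReal) rfl
  set φ : 𝓢(E, ℂ) := hgc'.toSchwartzMap hg' with hφ
  have hφg : ∀ x, φ x = (g x : ℂ) := fun x ↦ rfl
  have h1 := congrArg (fun T ↦ T φ) (Lp.fourierInv_toTemperedDistribution_eq G)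
  simp only [TemperedDistribution.fourierInv_apply, Lp.toTemperedDistribution_apply] at h1
  simp only [smul_eq_mul, hφg] at h1
  simp only [Complex.real_smul]
  rw [← h1]
  have h2 := integral_fourierInv_mul (integrable_bracket_mul hr F) φ.integrable
  simp only [hφg] at h2
  have h3 : ∫ x, (g x : ℂ) * synth r F x = ∫ x, synth r F x * (g x : ℂ) := by
    simp_rw [mul_comm]
  rw [h3]
  unfold synth
  rw [h2]
  apply integral_congr_ae
  filter_upwards [hG] with ξ hξ
  rw [hξ, SchwartzMap.fourierInv_coe, mul_comm]

/-- The `L²` Fourier transform is injective and the weight never vanishes. This lets identities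
between symbols be verified on values at points. -/
theorem synth_injective (hr : (finrank ℝ E : ℝ) < 2 * r) {F G : Lp ℂ 2 (volume : Measure E)}
    (h : ∀ x, synth r F x = synth r G x) : F = G := by
  have hr0 : 0 ≤ r := by
    have : (0 : ℝ) ≤ finrank ℝ E := by positivity
    linarith
  have hb : MemLp (fun ξ : E ↦ (bracket (-r) ξ : ℂ)) ∞ volume := memLp_top_bracket (by linarith)
  have h1 : (𝓕⁻ (mulOp (fun ξ ↦ (bracket (-r) ξ : ℂ)) F) : Lp ℂ 2 (volume : Measure E)) =
      𝓕⁻ (mulOp (fun ξ ↦ (bracket (-r) ξ : ℂ)) G) := by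
    apply Lp.ext
    filter_upwards [coeFn_fourierInv_mulOp_bracket hr F,
      coeFn_fourierInv_mulOp_bracket hr G] with x e1 e2
    rw [e1, e2, h]
  have h2 := (Lp.fourierTransformₗᵢ E ℂ).symm.injective h1
  apply Lp.ext
  have h3 := coeFn_mulOp hb G
  rw [← h2] at h3
  filter_upwards [coeFn_mulOp hb F, h3] with ξ e1 e2
  exact mul_left_cancel₀ (bracket_ne_zero _ _) (e1.symm.trans e2)

end Synthesis

/-! ### Derivatives and the Laplacian as multipliers. -/

section Derivatives

variable {E : Type*} [NormedAddCommGroup E] [InnerProductSpace ℝ E] [FiniteDimensional ℝ E]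
  [MeasurableSpace E] [BorelSpace E] {r : ℝ}

/-- The symbol of `∂_v (1 - Δ/(4π²))^(-1/2)`. -/
def gradSymbol (v ξ : E) : ℂ := 2 * Real.pi * Complex.I * (inner ℝ ξ v : ℝ) * (bracket (-1) ξ : ℂ)

theorem continuous_gradSymbol (v : E) : Continuous (gradSymbol v) := by
  unfold gradSymbol
  have : Continuous fun ξ : E ↦ ((inner ℝ ξ v : ℝ) : ℂ) :=
    Complex.continuous_ofReal.comp (by fun_prop)
  fun_prop

theorem norm_gradSymbol_le (v ξ : E) : ‖gradSymbol v ξ‖ ≤ 2 * Real.pi * ‖v‖ := by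
  unfold gradSymbol
  rw [norm_mul, norm_mul, norm_ofReal_bracket]
  have h1 : ‖(2 * Real.pi * Complex.I : ℂ)‖ = 2 * Real.pi := by
    simp [abs_of_pos Real.pi_pos]
  have h2 : ‖((inner ℝ ξ v : ℝ) : ℂ)‖ ≤ ‖ξ‖ * ‖v‖ := by
    rw [Complex.norm_real]; exact norm_inner_le_norm ξ v
  rw [h1]
  have h3 := norm_mul_bracket_le_one ξ
  have h4 := bracket_pos (-1) ξ
  have h5 := Real.pi_pos
  calc 2 * Real.pi * ‖((inner ℝ ξ v : ℝ) : ℂ)‖ * bracket (-1) ξ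
      ≤ 2 * Real.pi * (‖ξ‖ * ‖v‖) * bracket (-1) ξ := by gcongr
    _ = 2 * Real.pi * ‖v‖ * (‖ξ‖ * bracket (-1) ξ) := by ring
    _ ≤ 2 * Real.pi * ‖v‖ * 1 := by gcongr
    _ = _ := mul_one _

theorem memLp_top_gradSymbol (v : E) : MemLp (gradSymbol v) ∞ volume :=
  memLp_top_of_continuous_of_le (continuous_gradSymbol v) (norm_gradSymbol_le v)

/-- Since `|ξ|^k` is at most the weight of order `k`, each power of `|ξ|` costs one Sobolev order.
This is the decay needed to differentiate `k` times under the integral. -/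
theorem integrable_norm_pow_mul_bracket_mul (k : ℕ) (hr : (finrank ℝ E : ℝ) < 2 * (r - k))
    (F : Lp ℂ 2 (volume : Measure E)) :
    Integrable (fun ξ ↦ ‖ξ‖ ^ k * ‖(bracket (-r) ξ : ℂ) * F ξ‖) volume := by
  have h := (integrable_bracket_mul hr F).norm
  have h0 := integrable_bracket_mul (r := r) (by
    have : (0 : ℝ) ≤ k := by positivity
    linarith) F
  refine h.mono' ((by fun_prop : Continuous fun ξ : E ↦ ‖ξ‖ ^ k).aestronglyMeasurable.mul
    h0.norm.aestronglyMeasurable) (.of_forall fun ξ ↦ ?_)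
  have hk : ‖ξ‖ ^ k ≤ bracket k ξ := by
    have h1 : bracket (k : ℝ) ξ = bracket 1 ξ ^ k := by
      unfold bracket
      rw [← Real.rpow_mul_natCast (by positivity)]
      ring_nf
    rw [h1]
    exact pow_le_pow_left₀ (norm_nonneg _) (norm_le_bracket_one ξ) k
  rw [norm_mul, norm_mul, norm_mul, norm_norm, norm_mul, norm_ofReal_bracket, norm_ofReal_bracket,
    norm_pow, norm_norm, norm_norm]
  have h2 : bracket (-(r - k)) ξ = bracket k ξ * bracket (-r) ξ := by
    rw [← bracket_add]; ring_nf
  rw [h2, mul_assoc]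
  exact mul_le_mul_of_nonneg_right hk
    (mul_nonneg (bracket_pos (-r) ξ).le (norm_nonneg (F ξ)))

theorem contDiff_synth (k : ℕ) (hr : (finrank ℝ E : ℝ) < 2 * (r - k))
    (F : Lp ℂ 2 (volume : Measure E)) : ContDiff ℝ k (synth r F) := by
  have h : ContDiff ℝ k (𝓕 fun ξ ↦ (bracket (-r) ξ : ℂ) * F ξ) := by
    refine Real.contDiff_fourier (N := k) fun j hj ↦ integrable_norm_pow_mul_bracket_mul j ?_ F
    have : (j : ℝ) ≤ k := by exact_mod_cast hj
    linarith
  have h2 : synth r F = fun x ↦ 𝓕 (fun ξ ↦ (bracket (-r) ξ : ℂ) * F ξ) (-x) := by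
    ext x
    exact Real.fourierInv_eq_fourier_neg _ _
  rw [h2]
  exact h.comp contDiff_neg

/-- Differentiation brings down the factor `2πi⟨ξ, v⟩`. Lowering the order from `r` to `r - 1`
normalizes this factor to a bounded symbol. -/
theorem fderiv_synth_apply (hr : (finrank ℝ E : ℝ) < 2 * (r - 1))
    (F : Lp ℂ 2 (volume : Measure E)) (x v : E) :
    fderiv ℝ (synth r F) x v = synth (r - 1) (mulOp (gradSymbol v) F) x := by
  set φ : E → ℂ := fun ξ ↦ (bracket (-r) ξ : ℂ) * F ξ with hφ
  have h0 : Integrable φ := integrable_bracket_mul (by linarith) F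
  have h1 : Integrable (fun ξ ↦ ‖ξ‖ * ‖φ ξ‖) := by
    have := integrable_norm_pow_mul_bracket_mul 1 (by simpa using hr) F
    simpa only [pow_one] using this
  have h2 := (Real.hasFDerivAt_fourier h0 h1 (-x)).comp x (hasFDerivAt_id x).neg
  have h3 : synth r F = 𝓕 φ ∘ fun x ↦ -x := by
    ext x
    exact Real.fourierInv_eq_fourier_neg _ _
  rw [h3, h2.fderiv]
  have h4 : Integrable (VectorFourier.fourierSMulRight (innerSL ℝ) φ) := by
    refine (h1.const_mul (2 * Real.pi * ‖innerSL ℝ (E := E)‖)).mono'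
      h0.aestronglyMeasurable.fourierSMulRight (.of_forall fun ξ ↦ ?_)
    refine (VectorFourier.norm_fourierSMulRight_le _ _ _).trans (le_of_eq ?_)
    ring
  rw [ContinuousLinearMap.comp_apply, Real.fourier_continuousLinearMap_apply h4, synth,
    Real.fourierInv_eq_fourier_neg]
  apply Real.fourier_congr_ae
  filter_upwards [coeFn_mulOp (memLp_top_gradSymbol v) F] with ξ hξ
  have h5 : (bracket (-(r - 1)) ξ : ℂ) * (bracket (-1) ξ : ℂ) = (bracket (-r) ξ : ℂ) := by
    rw [← Complex.ofReal_mul, ← bracket_add]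
    congr 2
    ring
  rw [hξ, VectorFourier.fourierSMulRight_apply]
  have h6 : (innerSL ℝ ξ) (-v) = -inner ℝ ξ v := by
    rw [innerSL_apply_apply, inner_neg_right]
  simp only [hφ, ← h5, gradSymbol, neg_apply, ContinuousLinearMap.id_apply, h6, smul_eq_mul,
    Complex.real_smul]
  push_cast
  ring

/-- The symbol of `Δ (1 - Δ/(4π²))⁻¹`. -/
def laplaceSymbol (ξ : E) : ℂ := -(4 * Real.pi ^ 2 * (‖ξ‖ : ℂ) ^ 2 * (bracket (-2) ξ : ℂ))

theorem continuous_laplaceSymbol : Continuous (laplaceSymbol : E → ℂ) := by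
  unfold laplaceSymbol
  fun_prop

theorem norm_sq_mul_bracket_le_one (ξ : E) : ‖ξ‖ ^ 2 * bracket (-2) ξ ≤ 1 := by
  rw [← bracket_mul_bracket_neg 2 ξ, bracket_two]
  have := bracket_pos (-2) ξ
  nlinarith

theorem norm_laplaceSymbol_le (ξ : E) : ‖laplaceSymbol ξ‖ ≤ 4 * Real.pi ^ 2 := by
  unfold laplaceSymbol
  rw [norm_neg, norm_mul, norm_ofReal_bracket, norm_mul, norm_mul, norm_pow, norm_pow,
    Complex.norm_real, Complex.norm_real, norm_norm, Real.norm_of_nonneg Real.pi_pos.le,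
    mul_assoc]
  have := norm_sq_mul_bracket_le_one ξ
  simp only [Complex.norm_ofNat]
  exact mul_le_of_le_one_right (by positivity) this

theorem memLp_top_laplaceSymbol : MemLp (laplaceSymbol : E → ℂ) ∞ volume :=
  memLp_top_of_continuous_of_le continuous_laplaceSymbol norm_laplaceSymbol_le

theorem sum_gradSymbol_mul_gradSymbol {ι : Type*} [Fintype ι] (e : OrthonormalBasis ι ℝ E)
    (ξ : E) : ∑ i, gradSymbol (e i) ξ * gradSymbol (e i) ξ = laplaceSymbol ξ := by
  have h1 : ∀ i, gradSymbol (e i) ξ * gradSymbol (e i) ξ =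
      -(4 * Real.pi ^ 2 * (bracket (-2) ξ : ℂ)) * ((inner ℝ ξ (e i) ^ 2 : ℝ) : ℂ) := by
    intro i
    have h2 : (bracket (-2) ξ : ℂ) = (bracket (-1) ξ : ℂ) * (bracket (-1) ξ : ℂ) := by
      rw [← Complex.ofReal_mul, ← bracket_add]
      norm_num
    unfold gradSymbol
    rw [h2]
    push_cast
    ring_nf
    rw [Complex.I_sq]
    ring
  simp_rw [h1]
  rw [← Finset.mul_sum, ← Complex.ofReal_sum]
  rw [e.sum_sq_inner_left]
  unfold laplaceSymbol
  push_cast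
  ring

theorem mulOp_finset_sum {ι : Type*} (s : Finset ι) {m : ι → E → ℂ}
    (hm : ∀ i, MemLp (m i) ∞ volume) :
    mulOp (fun ξ ↦ ∑ i ∈ s, m i ξ) = ∑ i ∈ s, mulOp (m i) := by
  classical
  ext1 F
  have hs : MemLp (fun ξ ↦ ∑ i ∈ s, m i ξ) ∞ volume := memLp_finsetSum s fun i _ ↦ hm i
  rw [mulOp_apply_eq_iff hs, sum_apply]
  have h1 := Lp.coeFn_finsetSum (p := 2) s (fun i ↦ mulOp (m i) F)
  have h2 : ∀ᵐ ξ ∂(volume : Measure E), ∀ i ∈ s, mulOp (m i) F ξ = m i ξ * F ξ :=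
    (ae_ball_iff s.countable_toSet).2 fun i _ ↦ coeFn_mulOp (hm i) F
  filter_upwards [h1, h2] with ξ e1 e2
  rw [e1, Finset.sum_apply, Finset.sum_mul]
  exact Finset.sum_congr rfl fun i hi ↦ (e2 i hi).symm

end Derivatives

/-! ### The heat kernel and its Fourier multiplier. -/

section Heat

variable {n : ℕ} {r t : ℝ}

/-- The symbol of the heat semigroup. -/
def heatSymbol {E : Type*} [NormedAddCommGroup E] (t : ℝ) (ξ : E) : ℂ :=
  (Real.exp (-(4 * Real.pi ^ 2 * t * ‖ξ‖ ^ 2)) : ℝ)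

theorem continuous_heatSymbol {E : Type*} [NormedAddCommGroup E] (t : ℝ) :
    Continuous (heatSymbol t : E → ℂ) := by
  unfold heatSymbol
  exact Complex.continuous_ofReal.comp (by fun_prop)

theorem norm_heatSymbol {E : Type*} [NormedAddCommGroup E] (t : ℝ) (ξ : E) :
    ‖heatSymbol t ξ‖ = Real.exp (-(4 * Real.pi ^ 2 * t * ‖ξ‖ ^ 2)) := by
  rw [heatSymbol, Complex.norm_real, Real.norm_of_nonneg (Real.exp_pos _).le]

theorem norm_heatSymbol_le {E : Type*} [NormedAddCommGroup E] (ht : 0 ≤ t) (ξ : E) :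
    ‖heatSymbol t ξ‖ ≤ 1 := by
  rw [norm_heatSymbol, Real.exp_le_one_iff, neg_nonpos]
  positivity

theorem memLp_top_heatSymbol {E : Type*} [NormedAddCommGroup E] [InnerProductSpace ℝ E]
    [FiniteDimensional ℝ E] [MeasurableSpace E] [BorelSpace E] (ht : 0 ≤ t) :
    MemLp (heatSymbol t : E → ℂ) ∞ volume :=
  memLp_top_of_continuous_of_le (continuous_heatSymbol t) (norm_heatSymbol_le ht)

theorem fourier_gaussian_eq_heatKernel (ht : 0 < t) (x y : EuclideanSpace ℝ (Fin n)) :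
    𝓕 (fun ξ : EuclideanSpace ℝ (Fin n) ↦ Complex.exp (-((4 * Real.pi ^ 2 * t : ℝ) : ℂ) * ‖ξ‖ ^ 2
      + 2 * Real.pi * Complex.I * (inner ℝ x ξ : ℝ))) y = (heatKernel n t (x - y) : ℂ) := by
  have hb : 0 < ((4 * Real.pi ^ 2 * t : ℝ) : ℂ).re := by
    rw [Complex.ofReal_re]; have := Real.pi_pos; positivity
  rw [fourier_gaussian_innerProductSpace' hb]
  unfold heatKernel
  have hpi := Real.pi_pos
  have e1 : (Real.pi / ((4 * Real.pi ^ 2 * t : ℝ) : ℂ)) ^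
      ((finrank ℝ (EuclideanSpace ℝ (Fin n)) : ℂ) / 2) =
      (((4 * Real.pi * t) ^ (-(n : ℝ) / 2) : ℝ) : ℂ) := by
    rw [finrank_euclideanSpace_fin, ← Complex.ofReal_div,
      show ((n : ℂ) / 2) = ((n / 2 : ℝ) : ℂ) by push_cast; rfl, ← Complex.ofReal_cpow (by positivity)]
    congr 1
    rw [neg_div, Real.rpow_neg (by positivity), ← Real.inv_rpow (by positivity)]
    congr 1
    field_simp
  rw [e1]
  push_cast
  congr 2
  have : (Real.pi : ℂ) ≠ 0 := by exact_mod_cast hpi.ne'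
  have : (t : ℂ) ≠ 0 := by exact_mod_cast ht.ne'
  field_simp

theorem integrable_heatKernel_sub (ht : 0 < t) (x : EuclideanSpace ℝ (Fin n)) :
    Integrable fun y ↦ heatKernel n t (x - y) := by
  have hb : 0 < (((4 * t)⁻¹ : ℝ) : ℂ).re := by rw [Complex.ofReal_re]; positivity
  have h := (GaussianFourier.integrable_cexp_neg_mul_sq_norm_add hb 0
    (0 : EuclideanSpace ℝ (Fin n))).re
  have h2 : Integrable fun y : EuclideanSpace ℝ (Fin n) ↦ heatKernel n t y := by
    refine (h.const_mul ((4 * Real.pi * t) ^ (-(n : ℝ) / 2))).congr (.of_forall fun y ↦ ?_)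
    simp only [zero_mul, add_zero, heatKernel]
    congr 1
    have : -(((4 * t)⁻¹ : ℝ) : ℂ) * (‖y‖ : ℂ) ^ 2 = ((-‖y‖ ^ 2 / (4 * t) : ℝ) : ℂ) := by
      push_cast; field_simp
    rw [this, ← Complex.ofReal_exp]
    rfl
  exact h2.comp_sub_left x

theorem integrable_heatKernel_mul (ht : 0 < t) {f : EuclideanSpace ℝ (Fin n) → ℝ}
    (hf : Continuous f) {C : ℝ} (hC : ∀ x, ‖f x‖ ≤ C) (x : EuclideanSpace ℝ (Fin n)) :
    Integrable fun y ↦ heatKernel n t (x - y) * f y :=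
  (integrable_heatKernel_sub ht x).mul_bdd hf.aestronglyMeasurable (.of_forall hC)

/-- The translated heat kernel is the Fourier transform of a modulated Gaussian `g`. Moving the
inverse transform across the pairing turns the convolution into an integral against `g`, which is
the heat symbol times the phase of evaluation at `x`. -/
theorem ofReal_heatConv_eq_synth (ht : 0 < t) (hr : (n : ℝ) < 2 * r)
    {F : Lp ℂ 2 (volume : Measure (EuclideanSpace ℝ (Fin n)))} {f : EuclideanSpace ℝ (Fin n) → ℝ}
    (hf : ∀ x, synth r F x = f x) (x : EuclideanSpace ℝ (Fin n)) :
    (heatConv n t f x : ℂ) = synth r (mulOp (heatSymbol t) F) x := by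
  have hpi := Real.pi_pos
  have hr' : (finrank ℝ (EuclideanSpace ℝ (Fin n)) : ℝ) < 2 * r := by simpa using hr
  set b : ℂ := ((4 * Real.pi ^ 2 * t : ℝ) : ℂ) with hb_def
  have hb : 0 < b.re := by rw [Complex.ofReal_re]; positivity
  set g : EuclideanSpace ℝ (Fin n) → ℂ := fun ξ ↦
    Complex.exp (-b * ‖ξ‖ ^ 2 + 2 * Real.pi * Complex.I * (inner ℝ x ξ : ℝ)) with hg
  have hgi : Integrable g := GaussianFourier.integrable_cexp_neg_mul_sq_norm_add hb _ x
  have hFg : 𝓕 g = fun y ↦ (heatKernel n t (x - y) : ℂ) := by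
    ext y; exact fourier_gaussian_eq_heatKernel ht x y
  have hFgi : Integrable (𝓕 g) := by rw [hFg]; exact (integrable_heatKernel_sub ht x).ofReal
  have hgc : Continuous g := by
    have : Continuous fun ξ : EuclideanSpace ℝ (Fin n) ↦ ((inner ℝ x ξ : ℝ) : ℂ) :=
      Complex.continuous_ofReal.comp (by fun_prop)
    fun_prop
  have hinv : 𝓕⁻ (𝓕 g) = g := hgc.fourierInv_fourier_eq hgi hFgi
  calc (heatConv n t f x : ℂ) = ∫ y, synth r F y * 𝓕 g y := by
        rw [heatConv, ← integral_complex_ofReal]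
        congr 1
        ext y
        rw [hf, hFg]
        push_cast
        ring
    _ = ∫ ξ, ((bracket (-r) ξ : ℂ) * F ξ) * g ξ := by
        rw [synth, integral_fourierInv_mul (integrable_bracket_mul hr' F) hFgi, hinv]
    _ = synth r (mulOp (heatSymbol t) F) x := by
        rw [synth_apply]
        apply integral_congr_ae
        filter_upwards [coeFn_mulOp (memLp_top_heatSymbol ht.le) F] with ξ hξ
        rw [hξ, hg, heatSymbol, Real.fourierChar_apply, hb_def, real_inner_comm]
        simp only [Complex.exp_add]
        push_cast
        ring_nf

end Heat

/-! ### Sobolev functions and their symbols. -/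

section Link

variable {n : ℕ} {s : ℝ}

namespace HSob

/-- The weighted Fourier transform `(1 + |ξ|²)^(s/2) 𝓕 f` of `f ∈ H^s`. -/
def symbol : HSob n s →ₗᵢ[ℝ] Lp ℂ 2 (volume : Measure (EuclideanSpace ℝ (Fin n))) where
  toLinearMap :=
    ((Lp.fourierTransformₗᵢ (EuclideanSpace ℝ (Fin n)) ℂ).toLinearEquiv.toLinearMap.restrictScalars
      ℝ) ∘ₗ bessel
  norm_map' f := (Lp.fourierTransformₗᵢ (EuclideanSpace ℝ (Fin n)) ℂ).norm_map (bessel f)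

theorem symbol_apply (f : HSob n s) : symbol f = 𝓕 (besselFun f) := rfl

theorem hasTemperateGrowth_bracket (r : ℝ) :
    (fun ξ : EuclideanSpace ℝ (Fin n) ↦ (bracket r ξ : ℂ)).HasTemperateGrowth := by
  unfold bracket
  fun_prop

/-- For `s ≥ 0` the weight of order `-s` is bounded, so this Bessel potential stays in `L²` and the
distributional multiplier is an honest multiplication operator. -/
theorem besselPotential_neg_toTemperedDistribution (hs : 0 ≤ s)
    (F : Lp ℂ 2 (volume : Measure (EuclideanSpace ℝ (Fin n)))) :
    TemperedDistribution.besselPotential (EuclideanSpace ℝ (Fin n)) ℂ (-s)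
      (Lp.toTemperedDistributionCLM ℂ volume 2 (𝓕⁻ F)) =
    Lp.toTemperedDistributionCLM ℂ volume 2
      (𝓕⁻ (mulOp (fun ξ ↦ (bracket (-s) ξ : ℂ)) F)) := by
  have hb : MemLp (fun ξ : EuclideanSpace ℝ (Fin n) ↦ (bracket (-s) ξ : ℂ)) ∞ volume :=
    memLp_top_bracket (by linarith)
  have h1 := Lp.toTemperedDistribution_smul_eq (p := ∞) (q := 2) (r := 2) (F := ℂ)
    (hasTemperateGrowth_bracket (n := n) (-s)) hb F
  have h2 : (hb.toLp • F : Lp ℂ 2 (volume : Measure (EuclideanSpace ℝ (Fin n)))) =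
      mulOp (fun ξ ↦ (bracket (-s) ξ : ℂ)) F := by
    apply Lp.ext
    filter_upwards [Lp.coeFn_lpSMul (r := 2) hb.toLp F, coeFn_mulOp hb F, hb.coeFn_toLp]
      with ξ e1 e2 e3
    rw [e1, e2, Pi.smul_apply', e3, smul_eq_mul]
  rw [h2] at h1
  rw [Lp.toTemperedDistributionCLM_apply, Lp.toTemperedDistributionCLM_apply,
    ← Lp.fourierInv_toTemperedDistribution_eq, ← Lp.fourierInv_toTemperedDistribution_eq, h1]
  rw [TemperedDistribution.besselPotential, TemperedDistribution.fourierMultiplierCLM_apply]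
  simp only [FourierTransform.fourier_fourierInv_eq]
  rfl

theorem complexify_toL2 (hs : 0 ≤ s) (f : HSob n s) :
    complexify n (toL2 f) = 𝓕⁻ (mulOp (fun ξ ↦ (bracket (-s) ξ : ℂ)) (symbol f)) := by
  apply toTemperedDistribution_injective n
  rw [← besselPotential_neg_toTemperedDistribution hs, symbol_apply,
    FourierTransform.fourierInv_fourier_eq, ← besselFun_spec,
    TemperedDistribution.besselPotential_besselPotential_apply, add_neg_cancel,
    TemperedDistribution.besselPotential_zero, ContinuousLinearMap.id_apply]

theorem synth_symbol (hs : (n : ℝ) < 2 * s) (f : HSob n s) (x : EuclideanSpace ℝ (Fin n)) :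
    synth s (symbol f) x = f.rep x := by
  have hs' : (finrank ℝ (EuclideanSpace ℝ (Fin n)) : ℝ) < 2 * s := by simpa using hs
  have hs0 : 0 ≤ s := by
    have : (0 : ℝ) ≤ n := by positivity
    linarith
  have hc := continuous_synth hs' (symbol f)
  have h1 := coeFn_fourierInv_mulOp_bracket hs' (symbol f)
  rw [← complexify_toL2 hs0] at h1
  have h2 : complexify n (toL2 f) =ᵐ[volume] fun x ↦ ((toL2 f x : ℝ) : ℂ) :=
    Complex.ofRealCLM.coeFn_compLp (toL2 f)
  have h3 : toL2 f =ᵐ[volume] fun x ↦ (synth s (symbol f) x).re := by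
    filter_upwards [h1, h2] with x e1 e2
    rw [← e1, e2, Complex.ofReal_re]
  have h4 : f.rep = fun x ↦ (synth s (symbol f) x).re :=
    rep_eq f _ (Complex.continuous_re.comp hc) h3
  -- The imaginary part vanishes almost everywhere because `f` is real-valued, hence everywhere by
  -- continuity.
  have h5 : synth s (symbol f) = fun x ↦ (((synth s (symbol f) x).re : ℝ) : ℂ) := by
    refine (Continuous.ae_eq_iff_eq volume hc
      (Complex.continuous_ofReal.comp (Complex.continuous_re.comp hc))).1 ?_
    filter_upwards [h1, h2, h3] with x e1 e2 e3
    change _ = (((synth s (symbol f) x).re : ℝ) : ℂ)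
    rw [← e3, ← e2, e1]
  rw [h4]
  exact congrFun h5 x

/-- Reality of the synthesized function is the only constraint on a symbol: taking the real part in
`L²` then loses nothing, and the Bessel potential of order `s` undoes the weight. It turns solutions
found among symbols back into elements of `HSob n s`. -/
theorem exists_symbol_eq (hs : (n : ℝ) < 2 * s)
    {F : Lp ℂ 2 (volume : Measure (EuclideanSpace ℝ (Fin n)))}
    (hF : ∀ x, (synth s F x).im = 0) : ∃ f : HSob n s, symbol f = F := by
  have hs' : (finrank ℝ (EuclideanSpace ℝ (Fin n)) : ℝ) < 2 * s := by simpa using hs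
  have hs0 : 0 ≤ s := by
    have : (0 : ℝ) ≤ n := by positivity
    linarith
  set G := (𝓕⁻ (mulOp (fun ξ ↦ (bracket (-s) ξ : ℂ)) F) :
    Lp ℂ 2 (volume : Measure (EuclideanSpace ℝ (Fin n)))) with hG
  have h1 : G =ᵐ[volume] synth s F := coeFn_fourierInv_mulOp_bracket hs' F
  set g := Complex.reCLM.compLp G with hg
  have h2 : complexify n g = G := by
    apply Lp.ext
    have e1 : complexify n g =ᵐ[volume] fun x ↦ ((g x : ℝ) : ℂ) :=
      Complex.ofRealCLM.coeFn_compLp g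
    have e2 : g =ᵐ[volume] fun x ↦ (G x).re := Complex.reCLM.coeFn_compLp G
    filter_upwards [h1, e1, e2] with x h e1 e2
    rw [e1, e2, h]
    exact Complex.ext rfl (hF x).symm
  have h3 : TemperedDistribution.besselPotential (EuclideanSpace ℝ (Fin n)) ℂ s
      (Lp.toTemperedDistributionCLM ℂ volume 2 (complexify n g)) =
      Lp.toTemperedDistributionCLM ℂ volume 2 (𝓕⁻ F) := by
    rw [h2, hG, ← besselPotential_neg_toTemperedDistribution hs0,
      TemperedDistribution.besselPotential_besselPotential_apply, neg_add_cancel,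
      TemperedDistribution.besselPotential_zero, ContinuousLinearMap.id_apply]
  let f : HSob n s := ⟨g, ⟨_, h3⟩⟩
  refine ⟨f, ?_⟩
  have h4 := besselFun_spec f
  have h5 : besselFun f = 𝓕⁻ F := by
    apply toTemperedDistribution_injective n
    rw [← h4]
    exact h3
  rw [symbol_apply, h5, FourierTransform.fourier_fourierInv_eq]

end HSob

end Link

/-! ### The algebra property for orders above half the dimension. -/

section Product

variable {E : Type*} [NormedAddCommGroup E] [InnerProductSpace ℝ E] [FiniteDimensional ℝ E]
  [MeasurableSpace E] [BorelSpace E] {r : ℝ}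

/-- The weight in the convolution estimate. -/
def convWeight (r : ℝ) (ξ η : E) : ℝ := bracket r ξ * (bracket (-r) η * bracket (-r) (ξ - η))

theorem convWeight_nonneg (r : ℝ) (ξ η : E) : 0 ≤ convWeight r ξ η :=
  mul_nonneg (bracket_pos _ _).le (mul_nonneg (bracket_pos _ _).le (bracket_pos _ _).le)

theorem convWeight_le (hr : 0 ≤ r) (ξ η : E) :
    convWeight r ξ η ≤ 2 ^ r * (bracket (-r) η + bracket (-r) (ξ - η)) := by
  have h := bracket_add_le hr η (ξ - η)
  rw [add_sub_cancel] at h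
  have p1 := bracket_pos (-r) η
  have p2 := bracket_pos (-r) (ξ - η)
  calc convWeight r ξ η
      ≤ (2 ^ r * (bracket r η + bracket r (ξ - η))) * (bracket (-r) η * bracket (-r) (ξ - η)) :=
        mul_le_mul_of_nonneg_right h (mul_pos p1 p2).le
    _ = 2 ^ r * ((bracket r η * bracket (-r) η) * bracket (-r) (ξ - η) +
        (bracket r (ξ - η) * bracket (-r) (ξ - η)) * bracket (-r) η) := by ring
    _ = _ := by rw [bracket_mul_bracket_neg, bracket_mul_bracket_neg]; ring

theorem convWeight_sq_le (hr : 0 ≤ r) (ξ η : E) :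
    convWeight r ξ η ^ 2 ≤
      2 * (2 ^ r) ^ 2 * (bracket (-(2 * r)) η + bracket (-(2 * r)) (ξ - η)) := by
  have e : ∀ ζ : E, bracket (-(2 * r)) ζ = bracket (-r) ζ ^ 2 := fun ζ ↦ by
    rw [sq, ← bracket_add]; ring_nf
  rw [e, e]
  calc convWeight r ξ η ^ 2 ≤ (2 ^ r * (bracket (-r) η + bracket (-r) (ξ - η))) ^ 2 :=
        pow_le_pow_left₀ (convWeight_nonneg _ _ _) (convWeight_le hr ξ η) 2
    _ = (2 ^ r) ^ 2 * (bracket (-r) η + bracket (-r) (ξ - η)) ^ 2 := by ring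
    _ ≤ (2 ^ r) ^ 2 * (2 * (bracket (-r) η ^ 2 + bracket (-r) (ξ - η) ^ 2)) := by
        gcongr
        nlinarith [sq_nonneg (bracket (-r) η - bracket (-r) (ξ - η))]
    _ = _ := by ring

/-- Peetre's inequality cancels the growing weight against one of the two decaying ones. What
remains is integrable because `2r` exceeds the dimension, and translation invariance makes the bound
uniform in `ξ`. -/
theorem exists_lintegral_convWeight_sq_le (hr : (finrank ℝ E : ℝ) < 2 * r) :
    ∃ K : ℝ, 0 ≤ K ∧ ∀ ξ : E,
      ∫⁻ η, ENNReal.ofReal (convWeight r ξ η) ^ 2 ≤ ENNReal.ofReal K := by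
  have hr0 : 0 ≤ r := by
    have : (0 : ℝ) ≤ finrank ℝ E := by positivity
    linarith
  have hi := integrable_bracket (E := E) hr
  refine ⟨2 * (2 ^ r) ^ 2 * (2 * ∫ η : E, bracket (-(2 * r)) η), ?_, fun ξ ↦ ?_⟩
  · have : 0 ≤ ∫ η : E, bracket (-(2 * r)) η := integral_nonneg fun η ↦ (bracket_pos _ η).le
    positivity
  have hi2 : Integrable fun η ↦ 2 * (2 ^ r) ^ 2 *
      (bracket (-(2 * r)) η + bracket (-(2 * r)) (ξ - η)) :=
    (hi.add (hi.comp_sub_left ξ)).const_mul _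
  calc ∫⁻ η, ENNReal.ofReal (convWeight r ξ η) ^ 2
      ≤ ∫⁻ η, ENNReal.ofReal (2 * (2 ^ r) ^ 2 *
          (bracket (-(2 * r)) η + bracket (-(2 * r)) (ξ - η))) := by
        refine lintegral_mono fun η ↦ ?_
        rw [← ENNReal.ofReal_pow (convWeight_nonneg _ _ _)]
        exact ENNReal.ofReal_le_ofReal (convWeight_sq_le hr0 ξ η)
    _ = ENNReal.ofReal (∫ η, 2 * (2 ^ r) ^ 2 *
          (bracket (-(2 * r)) η + bracket (-(2 * r)) (ξ - η))) := by
        rw [ofReal_integral_eq_lintegral_ofReal hi2 (.of_forall fun η ↦ ?_)]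
        have p1 := bracket_pos (-(2 * r)) η
        have p2 := bracket_pos (-(2 * r)) (ξ - η)
        simp only [Pi.zero_apply]
        positivity
    _ = _ := by
        rw [integral_const_mul, integral_add hi (hi.comp_sub_left ξ),
          integral_sub_left_eq_self (fun η ↦ bracket (-(2 * r)) η)]
        ring_nf

theorem lintegral_enorm_sq_eq (F : Lp ℂ 2 (volume : Measure E)) :
    ∫⁻ ξ, ‖F ξ‖ₑ ^ 2 = ‖F‖ₑ ^ 2 := by
  rw [Lp.enorm_def, eLpNorm_eq_lintegral_rpow_enorm_toReal (by norm_num) (by norm_num),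
    ← ENNReal.rpow_natCast, ← ENNReal.rpow_mul]
  simp

/-- Tonelli, then translation invariance in `ξ` for fixed `η`. -/
theorem lintegral_lintegral_enorm_sq_mul (F G : Lp ℂ 2 (volume : Measure E)) :
    ∫⁻ ξ, ∫⁻ η, (‖F η‖ₑ * ‖G (ξ - η)‖ₑ) ^ 2 = (‖F‖ₑ * ‖G‖ₑ) ^ 2 := by
  have hF : Measurable F := (Lp.stronglyMeasurable F).measurable
  have hG : Measurable G := (Lp.stronglyMeasurable G).measurable
  rw [lintegral_lintegral_swap (by fun_prop)]
  simp_rw [mul_pow]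
  have h : ∀ η : E, ∫⁻ ξ, ‖F η‖ₑ ^ 2 * ‖G (ξ - η)‖ₑ ^ 2 = ‖F η‖ₑ ^ 2 * ‖G‖ₑ ^ 2 := by
    intro η
    rw [lintegral_const_mul _ (by fun_prop),
      lintegral_sub_right_eq_self (fun ξ ↦ ‖G ξ‖ₑ ^ 2) η, lintegral_enorm_sq_eq]
  simp_rw [h]
  rw [lintegral_mul_const _ (by fun_prop), lintegral_enorm_sq_eq]

open scoped Convolution in
/-- For `r > n/2` the space of all `synth r F` is closed under products. -/
theorem exists_synth_eq_mul (hr : (finrank ℝ E : ℝ) < 2 * r) :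
    ∃ C : ℝ, 0 ≤ C ∧ ∀ F G : Lp ℂ 2 (volume : Measure E), ∃ H : Lp ℂ 2 (volume : Measure E),
      (∀ x, synth r H x = synth r F x * synth r G x) ∧ ‖H‖ ≤ C * ‖F‖ * ‖G‖ := by
  obtain ⟨K, hK0, hK⟩ := exists_lintegral_convWeight_sq_le (E := E) hr
  refine ⟨√K, Real.sqrt_nonneg K, fun F G ↦ ?_⟩
  have hF : Measurable F := (Lp.stronglyMeasurable F).measurable
  have hG : Measurable G := (Lp.stronglyMeasurable G).measurable
  set f : E → ℂ := fun ξ ↦ (bracket (-r) ξ : ℂ) * F ξ with hf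
  set g : E → ℂ := fun ξ ↦ (bracket (-r) ξ : ℂ) * G ξ with hg
  have hfi : Integrable f := integrable_bracket_mul hr F
  have hgi : Integrable g := integrable_bracket_mul hr G
  set h : E → ℂ := f ⋆[ContinuousLinearMap.mul ℂ ℂ] g with hh
  have hhi : Integrable h := hfi.integrable_convolution (ContinuousLinearMap.mul ℂ ℂ) hgi
  set H : E → ℂ := fun ξ ↦ (bracket r ξ : ℂ) * h ξ with hH
  have hHm : AEStronglyMeasurable H volume :=
    (continuous_ofReal_bracket r).aestronglyMeasurable.mul hhi.aestronglyMeasurable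
  -- All weights are gathered in `convWeight`, and Cauchy–Schwarz in `η` separates it from `F` and
  -- `G`.
  have hpt : ∀ ξ, ‖H ξ‖ₑ ^ 2 ≤ ENNReal.ofReal K * ∫⁻ η, (‖F η‖ₑ * ‖G (ξ - η)‖ₑ) ^ 2 := by
    intro ξ
    have h1 : ‖H ξ‖ₑ ≤ ∫⁻ η, ENNReal.ofReal (convWeight r ξ η) * (‖F η‖ₑ * ‖G (ξ - η)‖ₑ) := by
      have : H ξ = ∫ η, (bracket r ξ : ℂ) * (f η * g (ξ - η)) := by
        rw [integral_const_mul]; rfl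
      rw [this]
      refine (enorm_integral_le_lintegral_enorm _).trans (le_of_eq (lintegral_congr fun η ↦ ?_))
      have e : (bracket r ξ : ℂ) * (f η * g (ξ - η)) =
          ((convWeight r ξ η : ℝ) : ℂ) * (F η * G (ξ - η)) := by
        rw [hf, hg, convWeight]; push_cast; ring
      rw [e, enorm_mul, enorm_mul, ← ofReal_norm, Complex.norm_real,
        Real.norm_of_nonneg (convWeight_nonneg _ _ _)]
    have hw : Measurable fun η : E ↦ ENNReal.ofReal (convWeight r ξ η) := by
      unfold convWeight
      have := (continuous_bracket (E := E) (-r)).measurable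
      fun_prop
    have h2 := ENNReal.lintegral_mul_le_Lp_mul_Lq volume Real.HolderConjugate.two_two
      hw.aemeasurable (g := fun η ↦ ‖F η‖ₑ * ‖G (ξ - η)‖ₑ)
      (by fun_prop)
    have h3 := h1.trans h2
    calc ‖H ξ‖ₑ ^ 2 ≤ _ := pow_le_pow_left' h3 2
      _ = (∫⁻ η, ENNReal.ofReal (convWeight r ξ η) ^ 2) *
          ∫⁻ η, (‖F η‖ₑ * ‖G (ξ - η)‖ₑ) ^ 2 := by
        rw [mul_pow, ← ENNReal.rpow_natCast, ← ENNReal.rpow_natCast, ← ENNReal.rpow_mul,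
          ← ENNReal.rpow_mul]
        simp
      _ ≤ _ := by gcongr; exact hK ξ
  have hint : ∫⁻ ξ, ‖H ξ‖ₑ ^ 2 ≤ ENNReal.ofReal K * (‖F‖ₑ * ‖G‖ₑ) ^ 2 := by
    refine (lintegral_mono hpt).trans (le_of_eq ?_)
    rw [lintegral_const_mul' _ _ ENNReal.ofReal_ne_top, lintegral_lintegral_enorm_sq_mul]
  have hHL : MemLp H 2 volume := by
    refine ⟨hHm, ?_⟩
    rw [eLpNorm_lt_top_iff_lintegral_rpow_enorm_lt_top (by norm_num) (by norm_num)]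
    simp only [ENNReal.toReal_ofNat, ENNReal.rpow_ofNat]
    exact hint.trans_lt (by finiteness)
  refine ⟨hHL.toLp, fun x ↦ ?_, ?_⟩
  · have e1 : synth r hHL.toLp x = 𝓕⁻ h x := by
      apply Real.fourierInv_congr_ae
      filter_upwards [hHL.coeFn_toLp] with ξ hξ
      rw [hξ, hH, ← mul_assoc, ← Complex.ofReal_mul, mul_comm (bracket (-r) ξ),
        bracket_mul_bracket_neg, Complex.ofReal_one, one_mul]
    rw [e1, Real.fourierInv_eq_fourier_neg, hh, Real.fourier_mul_convolution_eq hfi hgi, synth,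
      synth, Real.fourierInv_eq_fourier_neg, Real.fourierInv_eq_fourier_neg]
  · have h1 : ‖hHL.toLp‖ₑ ^ 2 ≤ ENNReal.ofReal K * (‖F‖ₑ * ‖G‖ₑ) ^ 2 := by
      rw [← lintegral_enorm_sq_eq]
      refine le_trans (le_of_eq (lintegral_congr_ae ?_)) hint
      filter_upwards [hHL.coeFn_toLp] with ξ hξ
      rw [hξ]
    have h2 : ‖hHL.toLp‖ ^ 2 ≤ K * (‖F‖ * ‖G‖) ^ 2 := by
      rw [← ofReal_norm, ← ofReal_norm, ← ofReal_norm, ← ENNReal.ofReal_mul (norm_nonneg _),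
        ← ENNReal.ofReal_pow (norm_nonneg _), ← ENNReal.ofReal_pow (by positivity),
        ← ENNReal.ofReal_mul hK0] at h1
      exact (ENNReal.ofReal_le_ofReal_iff (by positivity)).1 h1
    apply le_of_sq_le_sq _ (by positivity)
    rw [mul_assoc, mul_pow, Real.sq_sqrt hK0]
    exact h2

/-- The bilinear map on symbols that corresponds to the product of functions. -/
theorem exists_mul_clm (hr : (finrank ℝ E : ℝ) < 2 * r) :
    ∃ P : Lp ℂ 2 (volume : Measure E) →L[ℂ] Lp ℂ 2 (volume : Measure E) →L[ℂ]
      Lp ℂ 2 (volume : Measure E),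
      ∀ F G x, synth r (P F G) x = synth r F x * synth r G x := by
  obtain ⟨C, -, hC⟩ := exists_synth_eq_mul (E := E) hr
  choose H hH hHn using hC
  have hadd : ∀ F G x, synth r (F + G) x = synth r F x + synth r G x := fun F G x ↦ by
    obtain ⟨L, hL⟩ := exists_synth_clm hr x
    simp_rw [← hL, map_add]
  have hsmul : ∀ (c : ℂ) F x, synth r (c • F) x = c * synth r F x := fun c F x ↦ by
    obtain ⟨L, hL⟩ := exists_synth_clm hr x
    simp_rw [← hL, map_smul, smul_eq_mul]
  -- `H` comes from a choice; it is bilinear because a symbol is determined by its values under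
  -- `synth`.
  refine ⟨LinearMap.mkContinuous₂ (LinearMap.mk₂ ℂ H ?_ ?_ ?_ ?_) C hHn, hH⟩
  · intro F F' G
    exact synth_injective hr fun x ↦ by simp only [hadd, hH]; ring
  · intro c F G
    exact synth_injective hr fun x ↦ by simp only [hsmul, hH]; ring
  · intro F G G'
    exact synth_injective hr fun x ↦ by simp only [hadd, hH]; ring
  · intro c F G
    exact synth_injective hr fun x ↦ by simp only [hsmul, hH]; ring

end Product

/-! ### Parabolic smoothing and the Duhamel integral. -/

section Duhamel

variable {E : Type*} [NormedAddCommGroup E] [InnerProductSpace ℝ E] [FiniteDimensional ℝ E]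
  [MeasurableSpace E] [BorelSpace E]

/-- The symbol of the heat semigroup as an operator that gains one derivative. -/
def smoothSymbol (t : ℝ) (ξ : E) : ℂ := (bracket 1 ξ : ℂ) * heatSymbol t ξ

/-- The singular bound for the smoothing of the heat semigroup. -/
def smoothBound (t : ℝ) : ℝ := 1 + t ^ (-(1 / 2) : ℝ)

theorem smoothBound_nonneg {t : ℝ} (ht : 0 ≤ t) : 0 ≤ smoothBound t := by
  unfold smoothBound; positivity

theorem continuous_smoothSymbol (t : ℝ) : Continuous (smoothSymbol t : E → ℂ) :=
  (continuous_ofReal_bracket 1).mul (continuous_heatSymbol t)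

/-- Parabolic scaling: with `p = √t ‖ξ‖` the claim is `p ≤ exp (4π²p²)`, which follows from `p ≤ 1 +
p²`. -/
theorem norm_mul_exp_neg_le {t : ℝ} (ht : 0 < t) (ξ : E) :
    ‖ξ‖ * Real.exp (-(4 * Real.pi ^ 2 * t * ‖ξ‖ ^ 2)) ≤ t ^ (-(1 / 2) : ℝ) := by
  rw [Real.rpow_neg ht.le, ← Real.sqrt_eq_rpow]
  have hs := Real.sqrt_pos.2 ht
  have hsq := Real.sq_sqrt ht.le
  set p := √t * ‖ξ‖ with hp
  have hp0 : 0 ≤ p := by positivity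
  have h1 : 4 * Real.pi ^ 2 * t * ‖ξ‖ ^ 2 = 4 * Real.pi ^ 2 * p ^ 2 := by
    rw [hp, mul_pow, hsq]; ring
  have hpi := Real.pi_gt_three
  have h2 : p ≤ Real.exp (4 * Real.pi ^ 2 * p ^ 2) := by
    have := Real.add_one_le_exp (4 * Real.pi ^ 2 * p ^ 2)
    have h3 : p ^ 2 ≤ 4 * Real.pi ^ 2 * p ^ 2 :=
      le_mul_of_one_le_left (sq_nonneg p) (by nlinarith)
    nlinarith [sq_nonneg (p - 1)]
  rw [h1, Real.exp_neg, ← div_eq_mul_inv, div_le_iff₀ (Real.exp_pos _), inv_mul_eq_div,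
    le_div_iff₀ hs, mul_comm]
  exact h2

theorem norm_smoothSymbol_le {t : ℝ} (ht : 0 < t) (ξ : E) :
    ‖smoothSymbol t ξ‖ ≤ smoothBound t := by
  rw [smoothSymbol, norm_mul, norm_ofReal_bracket, norm_heatSymbol]
  have h1 := norm_mul_exp_neg_le ht ξ
  have h2 : Real.exp (-(4 * Real.pi ^ 2 * t * ‖ξ‖ ^ 2)) ≤ 1 := by
    rw [Real.exp_le_one_iff, neg_nonpos]; positivity
  calc _ ≤ (1 + ‖ξ‖) * Real.exp (-(4 * Real.pi ^ 2 * t * ‖ξ‖ ^ 2)) :=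
        mul_le_mul_of_nonneg_right (bracket_one_le ξ) (Real.exp_pos _).le
    _ ≤ _ := by unfold smoothBound; linarith

theorem memLp_top_smoothSymbol {t : ℝ} (ht : 0 < t) :
    MemLp (smoothSymbol t : E → ℂ) ∞ volume :=
  memLp_top_of_continuous_of_le (continuous_smoothSymbol t) (norm_smoothSymbol_le ht)

theorem norm_mulOp_smoothSymbol_le {t : ℝ} (ht : 0 < t) (F : Lp ℂ 2 (volume : Measure E)) :
    ‖mulOp (smoothSymbol t) F‖ ≤ smoothBound t * ‖F‖ :=
  norm_mulOp_apply_le (continuous_smoothSymbol t).aestronglyMeasurable (norm_smoothSymbol_le ht) F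

theorem norm_mulOp_heatSymbol_le {t : ℝ} (ht : 0 ≤ t) (F : Lp ℂ 2 (volume : Measure E)) :
    ‖mulOp (heatSymbol t) F‖ ≤ ‖F‖ := by
  simpa using norm_mulOp_apply_le (continuous_heatSymbol t).aestronglyMeasurable
    (norm_heatSymbol_le ht) F

theorem continuous_heatSymbol_time (ξ : E) : Continuous fun t ↦ heatSymbol t ξ := by
  unfold heatSymbol
  exact Complex.continuous_ofReal.comp (by fun_prop)

theorem continuousOn_mulOp_heatSymbol (F : Lp ℂ 2 (volume : Measure E)) :
    ContinuousOn (fun t ↦ mulOp (heatSymbol t) F) (Ici 0) := by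
  intro t ht
  refine tendsto_mulOp_apply (C := 1) (.of_forall fun i ↦
      (continuous_heatSymbol i).aestronglyMeasurable)
    (continuous_heatSymbol t).aestronglyMeasurable ?_ (norm_heatSymbol_le ht) (fun ξ ↦
      ((continuous_heatSymbol_time ξ).tendsto t).mono_left nhdsWithin_le_nhds) tendsto_const_nhds
  filter_upwards [self_mem_nhdsWithin] with i hi using norm_heatSymbol_le hi

theorem smoothBound_anti {t t' : ℝ} (ht : 0 < t) (h : t ≤ t') : smoothBound t' ≤ smoothBound t := by
  unfold smoothBound
  have := Real.rpow_le_rpow_of_nonpos ht h (z := (-(1 / 2) : ℝ)) (by norm_num)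
  linarith

/-- The times eventually exceed `σ' / 2`, where the singular bound is uniform, so bounded pointwise
convergence of symbols applies. -/
theorem tendsto_mulOp_smoothSymbol {ι : Type*} {l : Filter ι} [l.IsCountablyGenerated]
    {σ : ι → ℝ} {σ' : ℝ} (hσ' : 0 < σ') (hσ : Tendsto σ l (𝓝 σ'))
    {F : ι → Lp ℂ 2 (volume : Measure E)} {F' : Lp ℂ 2 (volume : Measure E)}
    (hF : Tendsto F l (𝓝 F')) :
    Tendsto (fun i ↦ mulOp (smoothSymbol (σ i)) (F i)) l (𝓝 (mulOp (smoothSymbol σ') F')) := by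
  refine tendsto_mulOp_apply (C := smoothBound (σ' / 2)) (.of_forall fun i ↦
      (continuous_smoothSymbol _).aestronglyMeasurable)
    (continuous_smoothSymbol _).aestronglyMeasurable ?_ (fun ξ ↦ (norm_smoothSymbol_le hσ' ξ).trans
      (smoothBound_anti (by linarith) (by linarith))) (fun ξ ↦ ?_) hF
  · filter_upwards [hσ.eventually (lt_mem_nhds (show σ' / 2 < σ' by linarith))] with i hi ξ
    exact (norm_smoothSymbol_le (by linarith) ξ).trans (smoothBound_anti (by linarith) hi.le)
  · exact (((continuous_heatSymbol_time ξ).tendsto σ').comp hσ).const_mul _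

theorem intervalIntegrable_smoothBound (a b : ℝ) : IntervalIntegrable smoothBound volume a b :=
  intervalIntegrable_const.add (intervalIntegral.intervalIntegrable_rpow' (by norm_num))

/-- `∫₀ᵗ ` of the smoothing bound. -/
theorem integral_smoothBound (t : ℝ) :
    ∫ σ in (0 : ℝ)..t, smoothBound σ = t + 2 * t ^ (1 / 2 : ℝ) := by
  unfold smoothBound
  rw [intervalIntegral.integral_add intervalIntegrable_const
    (intervalIntegral.intervalIntegrable_rpow' (by norm_num)), integral_rpow (by norm_num)]
  norm_num
  ring

/-- The Duhamel integral, as an operator that gains one derivative. -/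
def duhamel (N : ℝ → Lp ℂ 2 (volume : Measure E)) (t : ℝ) : Lp ℂ 2 (volume : Measure E) :=
  ∫ τ in (0 : ℝ)..t, mulOp (smoothSymbol (t - τ)) (N τ)

variable {N : ℝ → Lp ℂ 2 (volume : Measure E)}

theorem continuousOn_smooth_integrand (hN : Continuous N) (t : ℝ) :
    ContinuousOn (fun τ ↦ mulOp (smoothSymbol (t - τ)) (N τ)) (Iio t) := by
  intro τ hτ
  exact tendsto_mulOp_smoothSymbol (sub_pos.2 hτ)
    (((continuous_const.sub continuous_id).tendsto τ).mono_left nhdsWithin_le_nhds)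
    (hN.continuousWithinAt)

theorem intervalIntegrable_smoothBound_sub_mul {φ : ℝ → ℝ} (hφ : Continuous φ) (t : ℝ) :
    IntervalIntegrable (fun τ ↦ smoothBound (t - τ) * φ τ) volume 0 t := by
  have h := ((intervalIntegrable_smoothBound t 0).comp_sub_left t)
  simp only [sub_self, sub_zero] at h
  exact h.mul_continuousOn hφ.continuousOn

theorem intervalIntegrable_smooth_integrand (hN : Continuous N) {t : ℝ} (ht : 0 ≤ t) :
    IntervalIntegrable (fun τ ↦ mulOp (smoothSymbol (t - τ)) (N τ)) volume 0 t := by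
  have h := intervalIntegrable_smoothBound_sub_mul hN.norm t
  rw [intervalIntegrable_iff_integrableOn_Ioo_of_le ht] at h ⊢
  refine h.mono' (((continuousOn_smooth_integrand hN t).mono Ioo_subset_Iio_self).aestronglyMeasurable
    measurableSet_Ioo) ((ae_restrict_iff' measurableSet_Ioo).2 (.of_forall fun τ hτ ↦ ?_))
  exact norm_mulOp_smoothSymbol_le (sub_pos.2 hτ.2) _

theorem norm_duhamel_le (hN : Continuous N) {t : ℝ} (ht : 0 ≤ t) :
    ‖duhamel N t‖ ≤ ∫ τ in (0 : ℝ)..t, smoothBound (t - τ) * ‖N τ‖ := by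
  refine intervalIntegral.norm_integral_le_of_norm_le ht ?_
    (intervalIntegrable_smoothBound_sub_mul hN.norm t)
  have : ∀ᵐ τ : ℝ, τ ≠ t := compl_mem_ae_iff.2 (measure_singleton t)
  filter_upwards [this] with τ h1 h2
  exact norm_mulOp_smoothSymbol_le (sub_pos.2 (lt_of_le_of_ne h2.2 h1)) _

theorem norm_duhamel_le_of_le (hN : Continuous N) {t T M : ℝ} (ht : 0 ≤ t) (htT : t ≤ T)
    (hM : ∀ τ, ‖N τ‖ ≤ M) : ‖duhamel N t‖ ≤ (T + 2 * T ^ (1 / 2 : ℝ)) * M := by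
  have hM0 : 0 ≤ M := (norm_nonneg _).trans (hM 0)
  calc ‖duhamel N t‖ ≤ ∫ τ in (0 : ℝ)..t, smoothBound (t - τ) * ‖N τ‖ := norm_duhamel_le hN ht
    _ ≤ ∫ τ in (0 : ℝ)..t, smoothBound (t - τ) * M := by
        refine intervalIntegral.integral_mono_on ht
          (intervalIntegrable_smoothBound_sub_mul hN.norm t)
          (intervalIntegrable_smoothBound_sub_mul continuous_const t) fun τ hτ ↦ ?_
        exact mul_le_mul_of_nonneg_left (hM τ) (smoothBound_nonneg (sub_nonneg.2 hτ.2))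
    _ = (t + 2 * t ^ (1 / 2 : ℝ)) * M := by
        rw [intervalIntegral.integral_mul_const,
          intervalIntegral.integral_comp_sub_left (fun σ ↦ smoothBound σ) t, sub_self, sub_zero,
          integral_smoothBound]
    _ ≤ _ := by gcongr

theorem duhamel_sub {N' : ℝ → Lp ℂ 2 (volume : Measure E)} (hN : Continuous N)
    (hN' : Continuous N') {t : ℝ} (ht : 0 ≤ t) :
    duhamel (fun τ ↦ N τ - N' τ) t = duhamel N t - duhamel N' t := by
  unfold duhamel
  simp_rw [map_sub]
  exact intervalIntegral.integral_sub (intervalIntegrable_smooth_integrand hN ht)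
    (intervalIntegrable_smooth_integrand hN' ht)

/-- The substitution `σ = t - τ` pins the singularity at `σ = 0` independently of `t`, so that
`smoothBound σ * M` dominates for all `t` at once. -/
theorem continuousOn_duhamel (hN : Continuous N) {M : ℝ} (hM : ∀ τ, ‖N τ‖ ≤ M) (T : ℝ) :
    ContinuousOn (duhamel N) (Icc 0 T) := by
  set G : ℝ → ℝ → Lp ℂ 2 (volume : Measure E) := fun t σ ↦
    if σ < t then mulOp (smoothSymbol σ) (N (t - σ)) else 0 with hG
  have hM0 : 0 ≤ M := (norm_nonneg _).trans (hM 0)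
  have hcont : ∀ t, ContinuousOn (fun σ ↦ mulOp (smoothSymbol σ) (N (t - σ))) (Ioi 0) := by
    intro t σ hσ
    exact tendsto_mulOp_smoothSymbol hσ (continuousWithinAt_id)
      ((hN.comp (continuous_const.sub continuous_id)).continuousWithinAt)
  have hmeas : ∀ t, AEStronglyMeasurable (G t) (volume.restrict (Ioc 0 T)) := by
    intro t
    have h1 : AEStronglyMeasurable (fun σ ↦ mulOp (smoothSymbol σ) (N (t - σ)))
        (volume.restrict (Ioc 0 T)) :=
      ((hcont t).mono Ioc_subset_Ioi_self).aestronglyMeasurable measurableSet_Ioc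
    have h2 : G t = (Iio t).indicator (fun σ ↦ mulOp (smoothSymbol σ) (N (t - σ))) := by
      ext1 σ
      simp only [hG, indicator_apply, mem_Iio]
    rw [h2]
    exact h1.indicator measurableSet_Iio
  have heq : ∀ t ∈ Icc 0 T, duhamel N t = ∫ σ in Ioc 0 T, G t σ := by
    intro t ht
    have h1 : duhamel N t = ∫ σ in (0 : ℝ)..t, mulOp (smoothSymbol σ) (N (t - σ)) := by
      have := intervalIntegral.integral_comp_sub_left (a := 0) (b := t)
        (fun σ ↦ mulOp (smoothSymbol σ) (N (t - σ))) t
      simpa [duhamel] using this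
    have h2 : G t = (Iio t).indicator (fun σ ↦ mulOp (smoothSymbol σ) (N (t - σ))) := by
      ext1 σ
      simp only [hG, indicator_apply, mem_Iio]
    have h3 : Ioc 0 T ∩ Iio t = Ioo 0 t := by
      ext σ
      simp only [mem_inter_iff, mem_Ioc, mem_Iio, mem_Ioo]
      constructor
      · rintro ⟨⟨h, -⟩, h'⟩; exact ⟨h, h'⟩
      · rintro ⟨h, h'⟩; exact ⟨⟨h, h'.le.trans ht.2⟩, h'⟩
    rw [h1, h2, setIntegral_indicator measurableSet_Iio, h3,
      intervalIntegral.integral_of_le ht.1, integral_Ioc_eq_integral_Ioo]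
  intro t₀ ht₀
  have key : ContinuousWithinAt (fun t ↦ ∫ σ in Ioc 0 T, G t σ) (Icc 0 T) t₀ := by
    refine continuousWithinAt_of_dominated (bound := fun σ ↦ smoothBound σ * M)
      (.of_forall hmeas) (.of_forall fun t ↦
        (ae_restrict_iff' measurableSet_Ioc).2 (.of_forall fun σ hσ ↦ ?_)) ?_ ?_
    · simp only [hG]
      split_ifs
      · exact (norm_mulOp_smoothSymbol_le hσ.1 _).trans
          (mul_le_mul_of_nonneg_left (hM _) (smoothBound_nonneg hσ.1.le))
      · rw [norm_zero]
        exact mul_nonneg (smoothBound_nonneg hσ.1.le) hM0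
    · have := (intervalIntegrable_smoothBound 0 T).mul_const M
      exact this.1
    -- Near `t₀` the condition `σ < t` does not depend on `t` unless `σ = t₀`, a null set.
    · have : ∀ᵐ σ : ℝ, σ ≠ t₀ := compl_mem_ae_iff.2 (measure_singleton t₀)
      refine (ae_restrict_iff' measurableSet_Ioc).2 ?_
      filter_upwards [this] with σ h1 h2
      apply ContinuousAt.continuousWithinAt
      rcases lt_or_gt_of_ne h1 with h | h
      · have h3 : (fun t ↦ G t σ) =ᶠ[𝓝 t₀] fun t ↦ mulOp (smoothSymbol σ) (N (t - σ)) := by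
          filter_upwards [lt_mem_nhds h] with t ht
          simp only [hG, if_pos ht]
        refine ContinuousAt.congr ?_ h3.symm
        exact ((mulOp (smoothSymbol σ)).continuous.comp
          (hN.comp (continuous_id.sub continuous_const))).continuousAt
      · have h3 : (fun t ↦ G t σ) =ᶠ[𝓝 t₀] fun _ ↦ 0 := by
          filter_upwards [gt_mem_nhds h] with t ht
          simp only [hG, if_neg (not_lt.2 (le_of_lt ht))]
        exact continuousAt_const.congr h3.symm
  exact key.congr heq (heq t₀ ht₀)

end Duhamel

/-! ### Frequency truncation and the reversible heat flow. -/

section Cutoff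

variable {E : Type*} [NormedAddCommGroup E] [InnerProductSpace ℝ E] [FiniteDimensional ℝ E]
  [MeasurableSpace E] [BorelSpace E]

open Classical in
/-- The frequency cutoff to the ball of radius `R`. -/
def cutSymbol (R : ℝ) (ξ : E) : ℂ := if ‖ξ‖ ≤ R then 1 else 0

/-- The truncated generator of the heat semigroup. -/
def genSymbol (R : ℝ) (ξ : E) : ℂ := cutSymbol R ξ * (-(4 * Real.pi ^ 2 * ‖ξ‖ ^ 2) : ℝ)

/-- The truncated heat flow, which is defined for all times. -/
def flowSymbol (R t : ℝ) (ξ : E) : ℂ := cutSymbol R ξ * heatSymbol t ξ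

theorem memLp_top_mul {m₁ m₂ : E → ℂ} (h₁ : MemLp m₁ ∞ volume) (h₂ : MemLp m₂ ∞ volume) :
    MemLp (fun ξ ↦ m₁ ξ * m₂ ξ) ∞ volume :=
  MemLp.mul (r := ∞) h₂ h₁

theorem measurable_cutSymbol (R : ℝ) : Measurable (cutSymbol R : E → ℂ) := by
  unfold cutSymbol
  exact Measurable.ite (measurableSet_le (by fun_prop) (by fun_prop)) measurable_const
    measurable_const

theorem cutSymbol_mul_self (R : ℝ) (ξ : E) : cutSymbol R ξ * cutSymbol R ξ = cutSymbol R ξ := by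
  unfold cutSymbol; split_ifs <;> simp

theorem norm_cutSymbol_mul_le {R C : ℝ} (hC : 0 ≤ C) {z : ℂ} {ξ : E} (h : ‖ξ‖ ≤ R → ‖z‖ ≤ C) :
    ‖cutSymbol R ξ * z‖ ≤ C := by
  unfold cutSymbol
  split_ifs with h'
  · simpa using h h'
  · simpa using hC

theorem memLp_top_cutSymbol (R : ℝ) : MemLp (cutSymbol R : E → ℂ) ∞ volume :=
  memLp_top_of_bound (measurable_cutSymbol R).aestronglyMeasurable 1 (.of_forall fun ξ ↦ by
    simpa using norm_cutSymbol_mul_le (R := R) (ξ := ξ) zero_le_one (z := 1) (by simp))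

theorem measurable_flowSymbol (R t : ℝ) : Measurable (flowSymbol R t : E → ℂ) :=
  (measurable_cutSymbol R).mul (continuous_heatSymbol t).measurable

theorem norm_flowSymbol_le (R t : ℝ) (ξ : E) :
    ‖flowSymbol R t ξ‖ ≤ Real.exp (4 * Real.pi ^ 2 * |t| * R ^ 2) := by
  refine norm_cutSymbol_mul_le (Real.exp_pos _).le fun h ↦ ?_
  rw [norm_heatSymbol, Real.exp_le_exp]
  have h2 : ‖ξ‖ ^ 2 ≤ R ^ 2 := pow_le_pow_left₀ (norm_nonneg _) h 2
  calc -(4 * Real.pi ^ 2 * t * ‖ξ‖ ^ 2) = 4 * Real.pi ^ 2 * (-t) * ‖ξ‖ ^ 2 := by ring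
    _ ≤ 4 * Real.pi ^ 2 * |t| * ‖ξ‖ ^ 2 := by gcongr; exact neg_le_abs t
    _ ≤ _ := by gcongr

theorem memLp_top_flowSymbol (R t : ℝ) : MemLp (flowSymbol R t : E → ℂ) ∞ volume :=
  memLp_top_of_bound (measurable_flowSymbol R t).aestronglyMeasurable _
    (.of_forall (norm_flowSymbol_le R t))

theorem memLp_top_genSymbol (R : ℝ) : MemLp (genSymbol R : E → ℂ) ∞ volume := by
  refine memLp_top_of_bound ((measurable_cutSymbol R).mul
    (Complex.continuous_ofReal.comp (by fun_prop)).measurable).aestronglyMeasurable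
    (4 * Real.pi ^ 2 * R ^ 2) (.of_forall fun ξ ↦ ?_)
  refine norm_cutSymbol_mul_le (by positivity) fun h ↦ ?_
  rw [Complex.norm_real, norm_neg, Real.norm_of_nonneg (by positivity)]
  gcongr

/-- Countably many balls exhaust the frequency space, so the exceptional null sets can be united. -/
theorem eq_of_mulOp_cutSymbol_eq {F G : Lp ℂ 2 (volume : Measure E)}
    (h : ∀ R : ℝ, mulOp (cutSymbol R) F = mulOp (cutSymbol R) G) : F = G := by
  apply Lp.ext
  have h1 : ∀ᵐ ξ : E, ∀ R : ℕ, cutSymbol (R : ℝ) ξ * F ξ = cutSymbol (R : ℝ) ξ * G ξ := by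
    rw [ae_all_iff]
    intro R
    have e := coeFn_mulOp (memLp_top_cutSymbol (R : ℝ)) G
    rw [← h] at e
    exact (coeFn_mulOp (memLp_top_cutSymbol (R : ℝ)) F).symm.trans e
  filter_upwards [h1] with ξ hξ
  obtain ⟨R, hR⟩ := exists_nat_ge ‖ξ‖
  simpa [cutSymbol, hR] using hξ R

theorem mulOp_bracket_injective {r : ℝ} (hr : r ≤ 0) {F G : Lp ℂ 2 (volume : Measure E)}
    (h : mulOp (fun ξ : E ↦ (bracket r ξ : ℂ)) F = mulOp (fun ξ ↦ (bracket r ξ : ℂ)) G) :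
    F = G := by
  apply Lp.ext
  have h3 := coeFn_mulOp (memLp_top_bracket hr) G
  rw [← h] at h3
  filter_upwards [coeFn_mulOp (memLp_top_bracket hr) F, h3] with ξ e1 e2
  exact mul_left_cancel₀ (bracket_ne_zero _ _) (e1.symm.trans e2)

/-- Second-order Taylor bound for the exponential, uniform over the ball of radius `R`; the
smallness of `h` keeps the exponent within the range of that bound. -/
theorem norm_heatSymbol_add_sub_le {R : ℝ} {ξ : E} (hξ : ‖ξ‖ ≤ R) (t h : ℝ)
    (hh : |h| * (4 * Real.pi ^ 2 * R ^ 2) ≤ 1) :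
    ‖heatSymbol (t + h) ξ - heatSymbol t ξ -
      (h : ℂ) * (((-(4 * Real.pi ^ 2 * ‖ξ‖ ^ 2) : ℝ) : ℂ) * heatSymbol t ξ)‖ ≤
      Real.exp (4 * Real.pi ^ 2 * |t| * R ^ 2) * (4 * Real.pi ^ 2 * R ^ 2) ^ 2 * h ^ 2 := by
  set a := -(4 * Real.pi ^ 2 * ‖ξ‖ ^ 2) with ha
  have haR : |a| ≤ 4 * Real.pi ^ 2 * R ^ 2 := by
    rw [ha, abs_neg, abs_of_nonneg (by positivity)]
    gcongr
  have e : ∀ t, heatSymbol t ξ = (Real.exp (t * a) : ℝ) := fun t ↦ by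
    unfold heatSymbol; congr 2; rw [ha]; ring
  rw [e, e, ← Complex.ofReal_mul, ← Complex.ofReal_mul, ← Complex.ofReal_sub,
    ← Complex.ofReal_sub, Complex.norm_real, Real.norm_eq_abs]
  have h1 : Real.exp ((t + h) * a) - Real.exp (t * a) - h * (a * Real.exp (t * a)) =
      Real.exp (t * a) * (Real.exp (h * a) - 1 - h * a) := by
    rw [add_mul, Real.exp_add]; ring
  have h2 : |h * a| ≤ |h| * (4 * Real.pi ^ 2 * R ^ 2) := by
    rw [abs_mul]; gcongr
  have h3 := Real.abs_exp_sub_one_sub_id_le (h2.trans hh)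
  have h4 : Real.exp (t * a) ≤ Real.exp (4 * Real.pi ^ 2 * |t| * R ^ 2) := by
    rw [Real.exp_le_exp]
    calc t * a ≤ |t * a| := le_abs_self _
      _ = |t| * |a| := abs_mul _ _
      _ ≤ |t| * (4 * Real.pi ^ 2 * R ^ 2) := by gcongr
      _ = _ := by ring
  rw [h1, abs_mul, abs_of_pos (Real.exp_pos _), mul_assoc]
  refine mul_le_mul h4 (h3.trans ?_) (abs_nonneg _) (Real.exp_pos _).le
  calc (h * a) ^ 2 = |a| ^ 2 * h ^ 2 := by rw [sq_abs]; ring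
    _ ≤ _ := by gcongr

/-- The truncated generator is bounded, so the flow is differentiable in operator norm at every real
time: the Taylor remainder is `O(h²)` uniformly in `ξ`. -/
theorem hasDerivAt_mulOp_flowSymbol (R t : ℝ) :
    HasDerivAt (fun t ↦ mulOp (flowSymbol R t : E → ℂ))
      (mulOp (fun ξ : E ↦ genSymbol R ξ * flowSymbol R t ξ)) t := by
  rw [hasDerivAt_iff_isLittleO_nhds_zero]
  set K := Real.exp (4 * Real.pi ^ 2 * |t| * R ^ 2) * (4 * Real.pi ^ 2 * R ^ 2) ^ 2
  have hO : (fun h : ℝ ↦ mulOp (flowSymbol R (t + h) : E → ℂ) - mulOp (flowSymbol R t) -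
      h • mulOp (fun ξ : E ↦ genSymbol R ξ * flowSymbol R t ξ)) =O[𝓝 0] fun h ↦ h ^ 2 := by
    refine Asymptotics.IsBigO.of_bound K ?_
    have hev : ∀ᶠ h : ℝ in 𝓝 0, |h| * (4 * Real.pi ^ 2 * R ^ 2) < 1 := by
      have : Tendsto (fun h : ℝ ↦ |h| * (4 * Real.pi ^ 2 * R ^ 2)) (𝓝 0) (𝓝 0) := by
        have h0 : Continuous fun h : ℝ ↦ |h| * (4 * Real.pi ^ 2 * R ^ 2) := by fun_prop
        simpa using h0.tendsto 0
      exact this.eventually (gt_mem_nhds one_pos)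
    filter_upwards [hev] with h hh
    have m1 := memLp_top_flowSymbol (E := E) R (t + h)
    have m2 := memLp_top_flowSymbol (E := E) R t
    have m3 : MemLp (fun ξ : E ↦ genSymbol R ξ * flowSymbol R t ξ) ∞ volume :=
      memLp_top_mul (memLp_top_genSymbol R) m2
    have e : mulOp (flowSymbol R (t + h) : E → ℂ) - mulOp (flowSymbol R t) -
        h • mulOp (fun ξ : E ↦ genSymbol R ξ * flowSymbol R t ξ) =
        mulOp (fun ξ ↦ flowSymbol R (t + h) ξ - flowSymbol R t ξ -
          (h : ℂ) * (genSymbol R ξ * flowSymbol R t ξ)) := by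
      rw [mulOp_sub (m₁ := fun ξ ↦ flowSymbol R (t + h) ξ - flowSymbol R t ξ) (m1.sub m2)
        (m3.const_mul (h : ℂ)), mulOp_sub m1 m2, mulOp_const_mul m3]
      congr 1
    rw [e, Real.norm_of_nonneg (sq_nonneg h)]
    refine norm_mulOp_le ((m1.sub m2).sub (m3.const_mul (h : ℂ))).1 (by positivity) fun ξ ↦ ?_
    have e2 : flowSymbol R (t + h) ξ - flowSymbol R t ξ -
        (h : ℂ) * (genSymbol R ξ * flowSymbol R t ξ) = cutSymbol R ξ *
        (heatSymbol (t + h) ξ - heatSymbol t ξ -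
      (h : ℂ) * (((-(4 * Real.pi ^ 2 * ‖ξ‖ ^ 2) : ℝ) : ℂ) * heatSymbol t ξ)) := by
      simp only [flowSymbol, genSymbol]
      linear_combination (-(h : ℂ) * (((-(4 * Real.pi ^ 2 * ‖ξ‖ ^ 2) : ℝ) : ℂ) * heatSymbol t ξ)) *
        cutSymbol_mul_self R ξ
    change ‖flowSymbol R (t + h) ξ - flowSymbol R t ξ -
        (h : ℂ) * (genSymbol R ξ * flowSymbol R t ξ)‖ ≤ _
    rw [e2]
    exact norm_cutSymbol_mul_le (by positivity) fun hξ ↦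
      norm_heatSymbol_add_sub_le hξ t h hh.le
  exact hO.trans_isLittleO (by simpa using Asymptotics.isLittleO_pow_id (one_lt_two) (𝕜 := ℝ))

theorem continuous_mulOp_flowSymbol (R : ℝ) :
    Continuous fun t ↦ mulOp (flowSymbol R t : E → ℂ) :=
  continuous_iff_continuousAt.2 fun t ↦ (hasDerivAt_mulOp_flowSymbol R t).continuousAt

end Cutoff

/-! ### Mild equation versus integrated differential equation. -/

section Equation

variable {E : Type*} [NormedAddCommGroup E] [InnerProductSpace ℝ E] [FiniteDimensional ℝ E]
  [MeasurableSpace E] [BorelSpace E]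

theorem mulOp_cut_laplace (R : ℝ) (F : Lp ℂ 2 (volume : Measure E)) :
    mulOp (cutSymbol R) (mulOp laplaceSymbol F) =
      mulOp (genSymbol R) (mulOp (cutSymbol R) (mulOp (fun ξ ↦ (bracket (-2) ξ : ℂ)) F)) := by
  have hb := memLp_top_bracket (E := E) (r := -2) (by norm_num)
  rw [mulOp_mulOp (memLp_top_cutSymbol R) hb (fun ξ ↦ rfl),
    mulOp_mulOp (memLp_top_genSymbol R) (memLp_top_mul (memLp_top_cutSymbol R) hb)
      (fun ξ ↦ rfl), mulOp_mulOp (memLp_top_cutSymbol R) memLp_top_laplaceSymbol]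
  intro ξ
  simp only [genSymbol, laplaceSymbol]
  push_cast
  linear_combination (4 * Real.pi ^ 2 * (‖ξ‖ : ℂ) ^ 2 * (bracket (-2) ξ : ℂ)) *
    cutSymbol_mul_self R ξ

theorem mulOp_cut_heat (R : ℝ) {t : ℝ} (ht : 0 ≤ t) (F : Lp ℂ 2 (volume : Measure E)) :
    mulOp (cutSymbol R) (mulOp (fun ξ ↦ (bracket (-2) ξ : ℂ)) (mulOp (heatSymbol t) F)) =
      mulOp (flowSymbol R t) (mulOp (fun ξ ↦ (bracket (-2) ξ : ℂ)) F) := by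
  have hb := memLp_top_bracket (E := E) (r := -2) (by norm_num)
  rw [mulOp_mulOp hb (memLp_top_heatSymbol ht) (fun ξ ↦ rfl),
    mulOp_mulOp (memLp_top_cutSymbol R) (memLp_top_mul hb (memLp_top_heatSymbol ht))
      (fun ξ ↦ rfl), mulOp_mulOp (memLp_top_flowSymbol R t) hb]
  intro ξ
  simp only [flowSymbol]
  ring

theorem heatSymbol_add (t t' : ℝ) (ξ : E) :
    heatSymbol (t + t') ξ = heatSymbol t ξ * heatSymbol t' ξ := by
  unfold heatSymbol
  rw [← Complex.ofReal_mul, ← Real.exp_add]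
  congr 2
  ring

theorem heatSymbol_zero (ξ : E) : heatSymbol 0 ξ = 1 := by simp [heatSymbol]

theorem bracket_neg_two_mul_bracket_one (ξ : E) :
    (bracket (-2) ξ : ℂ) * (bracket 1 ξ : ℂ) = (bracket (-1) ξ : ℂ) := by
  rw [← Complex.ofReal_mul, ← bracket_add]
  norm_num

/-- On bounded frequencies the flow from `τ` to `t` factors through time zero. The `t`-dependence
can then leave the Duhamel integral, and lowering the order by two removes the singular smoothing
factor. -/
theorem mulOp_cut_smooth (R : ℝ) {t τ : ℝ} (ht : τ < t) (F : Lp ℂ 2 (volume : Measure E)) :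
    mulOp (cutSymbol R) (mulOp (fun ξ ↦ (bracket (-2) ξ : ℂ)) (mulOp (smoothSymbol (t - τ)) F)) =
      mulOp (flowSymbol R t) (mulOp (flowSymbol R (-τ)) (mulOp (fun ξ ↦ (bracket (-1) ξ : ℂ)) F)) := by
  have hb := memLp_top_bracket (E := E) (r := -2) (by norm_num)
  have hb1 := memLp_top_bracket (E := E) (r := -1) (by norm_num)
  have hs := memLp_top_smoothSymbol (E := E) (sub_pos.2 ht)
  rw [mulOp_mulOp hb hs (fun ξ ↦ rfl),
    mulOp_mulOp (memLp_top_cutSymbol R) (memLp_top_mul hb hs) (fun ξ ↦ rfl),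
    mulOp_mulOp (memLp_top_flowSymbol R (-τ)) hb1 (fun ξ ↦ rfl),
    mulOp_mulOp (memLp_top_flowSymbol R t) (memLp_top_mul (memLp_top_flowSymbol R (-τ)) hb1)]
  intro ξ
  simp only [flowSymbol, smoothSymbol, sub_eq_add_neg t τ, heatSymbol_add]
  linear_combination (heatSymbol t ξ * heatSymbol (-τ) ξ * (bracket (-1) ξ : ℂ)) *
    cutSymbol_mul_self R ξ - (cutSymbol R ξ * heatSymbol t ξ * heatSymbol (-τ) ξ) *
      bracket_neg_two_mul_bracket_one ξ

theorem mulOp_flow_flow_neg (R t : ℝ) (F : Lp ℂ 2 (volume : Measure E)) :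
    mulOp (flowSymbol R t) (mulOp (flowSymbol R (-t)) F) = mulOp (cutSymbol R) F := by
  rw [mulOp_mulOp (memLp_top_flowSymbol R t) (memLp_top_flowSymbol R (-t))]
  intro ξ
  have h := heatSymbol_add t (-t) ξ
  rw [add_neg_cancel, heatSymbol_zero] at h
  simp only [flowSymbol]
  linear_combination cutSymbol_mul_self R ξ - cutSymbol R ξ * cutSymbol R ξ * h

theorem flowSymbol_zero (R : ℝ) : (flowSymbol R 0 : E → ℂ) = cutSymbol R := by
  ext ξ
  rw [flowSymbol, heatSymbol_zero, mul_one]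

variable {N U : ℝ → Lp ℂ 2 (volume : Measure E)}

/-- The truncated solution of the linear equation with source `G`. -/
def cutSolution (R : ℝ) (V₀ : Lp ℂ 2 (volume : Measure E)) (G : ℝ → Lp ℂ 2 (volume : Measure E))
    (t : ℝ) : Lp ℂ 2 (volume : Measure E) :=
  mulOp (flowSymbol R t) (V₀ + ∫ τ in (0 : ℝ)..t, mulOp (flowSymbol R (-τ)) (G τ))

/-- Variation of constants: the product rule gives the generator term, and the flows at `t` and `-t`
compose to the cutoff in the source term. -/
theorem hasDerivAt_cutSolution (R : ℝ) (V₀ : Lp ℂ 2 (volume : Measure E))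
    {G : ℝ → Lp ℂ 2 (volume : Measure E)} (hG : Continuous G) (t : ℝ) :
    HasDerivAt (cutSolution R V₀ G)
      (mulOp (genSymbol R) (cutSolution R V₀ G t) + mulOp (cutSymbol R) (G t)) t := by
  have hc : Continuous fun τ ↦ mulOp (flowSymbol R (-τ)) (G τ) :=
    ((continuous_mulOp_flowSymbol R).comp continuous_neg).clm_apply hG
  have h1 : HasDerivAt (fun t ↦ V₀ + ∫ τ in (0 : ℝ)..t, mulOp (flowSymbol R (-τ)) (G τ))
      (mulOp (flowSymbol R (-t)) (G t)) t :=
    (hc.integral_hasStrictDerivAt 0 t).hasDerivAt.const_add V₀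
  -- Time is real while the operators are complex-linear; the product rule needs them as real-linear
  -- maps.
  have h2 := (ContinuousLinearMap.restrictScalarsL ℂ (Lp ℂ 2 (volume : Measure E))
    (Lp ℂ 2 (volume : Measure E)) ℝ ℝ).hasFDerivAt.comp_hasDerivAt t
      (hasDerivAt_mulOp_flowSymbol (E := E) R t)
  have h3 := h2.clm_apply h1
  refine h3.congr_deriv ?_
  change mulOp (fun ξ ↦ genSymbol R ξ * flowSymbol R t ξ) _ +
    mulOp (flowSymbol R t) (mulOp (flowSymbol R (-t)) (G t)) = _
  rw [mulOp_flow_flow_neg, cutSolution,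
    mulOp_mulOp (memLp_top_genSymbol R) (memLp_top_flowSymbol R t) (fun ξ ↦ rfl)]

theorem mulOp_cut_mild_eq_cutSolution (R : ℝ) (hN : Continuous N)
    {t : ℝ} (ht : 0 ≤ t) (U₀ : Lp ℂ 2 (volume : Measure E)) :
    mulOp (cutSymbol R) (mulOp (fun ξ ↦ (bracket (-2) ξ : ℂ))
      (mulOp (heatSymbol t) U₀ + duhamel N t)) =
    cutSolution R (mulOp (fun ξ ↦ (bracket (-2) ξ : ℂ)) U₀)
      (fun τ ↦ mulOp (fun ξ ↦ (bracket (-1) ξ : ℂ)) (N τ)) t := by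
  have hc : Continuous fun τ ↦ mulOp (flowSymbol R (-τ))
      (mulOp (fun ξ : E ↦ (bracket (-1) ξ : ℂ)) (N τ)) :=
    ((continuous_mulOp_flowSymbol R).comp continuous_neg).clm_apply
      ((mulOp _).continuous.comp hN)
  rw [map_add, map_add, mulOp_cut_heat R ht, cutSolution, map_add]
  congr 1
  rw [duhamel, ← ContinuousLinearMap.comp_apply,
    ← ContinuousLinearMap.intervalIntegral_comp_comm _ (intervalIntegrable_smooth_integrand hN ht),
    ← ContinuousLinearMap.intervalIntegral_comp_comm _ (hc.intervalIntegrable 0 t)]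
  apply intervalIntegral.integral_congr_ae
  have : ∀ᵐ τ : ℝ, τ ≠ t := compl_mem_ae_iff.2 (measure_singleton t)
  filter_upwards [this] with τ h1 h2
  rw [uIoc_of_le ht] at h2
  exact mulOp_cut_smooth R (lt_of_le_of_ne h2.2 h1) _

/-- Equivalence of the mild equation and the integrated differential equation. -/
theorem mild_iff_integrated (hU : Continuous U) (hN : Continuous N) (T : ℝ) :
    (∀ t ∈ Icc 0 T, U t = mulOp (heatSymbol t) (U 0) + duhamel N t) ↔
    ∀ t ∈ Icc 0 T, mulOp (fun ξ ↦ (bracket (-2) ξ : ℂ)) (U t) =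
      mulOp (fun ξ ↦ (bracket (-2) ξ : ℂ)) (U 0) + ∫ τ in (0 : ℝ)..t,
        (mulOp laplaceSymbol (U τ) + mulOp (fun ξ ↦ (bracket (-1) ξ : ℂ)) (N τ)) := by
  set J₂ := mulOp (fun ξ : E ↦ (bracket (-2) ξ : ℂ))
  set J₁ := mulOp (fun ξ : E ↦ (bracket (-1) ξ : ℂ))
  have hJN : Continuous fun τ ↦ J₁ (N τ) := J₁.continuous.comp hN
  have hg : Continuous fun τ ↦ mulOp laplaceSymbol (U τ) + J₁ (N τ) :=
    ((mulOp _).continuous.comp hU).add hJN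
  have hderiv : ∀ R t, HasDerivAt (fun t ↦ mulOp (cutSymbol R) (J₂ (U 0) + ∫ τ in (0 : ℝ)..t,
      (mulOp laplaceSymbol (U τ) + J₁ (N τ))))
      (mulOp (cutSymbol R) (mulOp laplaceSymbol (U t) + J₁ (N t))) t := fun R t ↦
    ((mulOp (cutSymbol R)).restrictScalars ℝ).hasFDerivAt.comp_hasDerivAt t
      ((hg.integral_hasStrictDerivAt 0 t).hasDerivAt.const_add _)
  have hy0 : ∀ R, cutSolution R (J₂ (U 0)) (fun τ ↦ J₁ (N τ)) 0 = mulOp (cutSymbol R) (J₂ (U 0)) :=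
    fun R ↦ by rw [cutSolution, intervalIntegral.integral_same, add_zero, flowSymbol_zero]
  have hyd := fun R ↦ hasDerivAt_cutSolution R (J₂ (U 0)) hJN
  constructor
  · intro h t ht
    apply eq_of_mulOp_cutSymbol_eq
    intro R
    -- `J₂` re-expresses an order-`s` symbol at order `s - 2`, and `J₁` one of order `s - 1`. The
    -- truncated mild solution is `cutSolution`, whose ODE is then integrated.
    have hy : ∀ τ ∈ Icc 0 T, mulOp (cutSymbol R) (J₂ (U τ)) =
        cutSolution R (J₂ (U 0)) (fun τ ↦ J₁ (N τ)) τ := fun τ hτ ↦ by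
      rw [← mulOp_cut_mild_eq_cutSolution R hN hτ.1, ← h τ hτ]
    have h1 : ∀ τ ∈ uIcc 0 t, HasDerivAt (cutSolution R (J₂ (U 0)) (fun τ ↦ J₁ (N τ)))
        (mulOp (cutSymbol R) (mulOp laplaceSymbol (U τ) + J₁ (N τ))) τ := by
      intro τ hτ
      rw [uIcc_of_le ht.1] at hτ
      have := hyd R τ
      rwa [← hy τ ⟨hτ.1, hτ.2.trans ht.2⟩, ← mulOp_cut_laplace, ← map_add] at this
    have h2 := intervalIntegral.integral_eq_sub_of_hasDerivAt h1
      (((mulOp (cutSymbol R)).continuous.comp hg).intervalIntegrable 0 t)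
    rw [ContinuousLinearMap.intervalIntegral_comp_comm _ (hg.intervalIntegrable 0 t), hy0,
      ← hy t ht] at h2
    rw [map_add, h2]
    abel
  · intro h t ht
    apply mulOp_bracket_injective (r := -2) (by norm_num)
    apply eq_of_mulOp_cutSymbol_eq
    intro R
    rw [mulOp_cut_mild_eq_cutSolution R hN ht.1]
    have hT : ∀ τ ∈ Ico 0 T, τ ∈ Icc 0 T := fun τ hτ ↦ Ico_subset_Icc_self hτ
    -- The truncated integrated equation and the truncated Duhamel formula solve the same linear ODE
    -- with a bounded generator and equal initial values.
    have key := ODE_solution_unique (a := 0) (b := T)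
      (v := fun t V ↦ mulOp (genSymbol R) V + mulOp (cutSymbol R) (J₁ (N t)))
      (K := ‖mulOp (genSymbol R : E → ℂ)‖₊)
      (f := fun t ↦ mulOp (cutSymbol R) (J₂ (U 0) + ∫ τ in (0 : ℝ)..t,
        (mulOp laplaceSymbol (U τ) + J₁ (N τ))))
      (g := cutSolution R (J₂ (U 0)) (fun τ ↦ J₁ (N τ)))
      (fun t ↦ by
        refine LipschitzWith.of_dist_le_mul fun V W ↦ ?_
        rw [dist_add_right, dist_eq_norm, dist_eq_norm, ← map_sub]
        exact (mulOp (genSymbol R)).le_opNorm _)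
      (fun τ _ ↦ (hderiv R τ).continuousAt.continuousWithinAt)
      (fun τ hτ ↦ by
        have := (hderiv R τ).hasDerivWithinAt (s := Ici τ)
        rw [map_add, mulOp_cut_laplace, h τ (hT τ hτ)] at this
        exact this)
      (fun τ _ ↦ (hyd R τ).continuousAt.continuousWithinAt)
      (fun τ _ ↦ (hyd R τ).hasDerivWithinAt)
      (by simp only [intervalIntegral.integral_same, add_zero, hy0])
    have hk := key ht
    simp only at hk
    rw [← hk, ← h t ht]

end Equation

/-! ### Gronwall's inequality with an integrable singularity. -/

section SingularGronwall

/-- Dominated convergence as `c → ∞`. This supplies an exponential weight in which the singular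
kernel has small mass, whatever the length of the interval. -/
theorem exists_integral_smoothBound_mul_exp_lt {T : ℝ} (hT : 0 ≤ T) {ε : ℝ} (hε : 0 < ε) :
    ∃ c : ℝ, ∫ σ in (0 : ℝ)..T, smoothBound σ * Real.exp (-(c * σ)) < ε := by
  have h : Tendsto (fun c : ℝ ↦ ∫ σ in (0 : ℝ)..T, smoothBound σ * Real.exp (-(c * σ))) atTop
      (𝓝 (∫ _ in (0 : ℝ)..T, (0 : ℝ))) := by
    refine intervalIntegral.tendsto_integral_filter_of_dominated_convergence smoothBound
      (.of_forall fun c ↦ ?_) ?_ (intervalIntegrable_smoothBound 0 T) (.of_forall fun σ hσ ↦ ?_)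
    · exact ((intervalIntegrable_smoothBound 0 T).def'.aestronglyMeasurable).mul
        (by fun_prop : Continuous fun σ : ℝ ↦ Real.exp (-(c * σ))).aestronglyMeasurable
    · filter_upwards [eventually_ge_atTop 0] with c hc
      refine .of_forall fun σ hσ ↦ ?_
      rw [uIoc_of_le hT] at hσ
      have h1 := smoothBound_nonneg hσ.1.le
      rw [Real.norm_of_nonneg (mul_nonneg h1 (Real.exp_pos _).le)]
      refine mul_le_of_le_one_right h1 ?_
      rw [Real.exp_le_one_iff, neg_nonpos]
      exact mul_nonneg hc hσ.1.le
    · rw [uIoc_of_le hT] at hσ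
      have h1 : Tendsto (fun c : ℝ ↦ Real.exp (-(c * σ))) atTop (𝓝 0) :=
        Real.tendsto_exp_neg_atTop_nhds_zero.comp (tendsto_id.atTop_mul_const hσ.1)
      simpa using h1.const_mul (smoothBound σ)
  rw [intervalIntegral.integral_zero] at h
  exact (h.eventually (gt_mem_nhds hε)).exists

/-- A Gronwall inequality with a weakly singular kernel. -/
theorem eq_zero_of_le_integral_smoothBound {φ : ℝ → ℝ} (hφ : Continuous φ) (hφ0 : ∀ t, 0 ≤ φ t)
    {L T : ℝ} (hL : 0 ≤ L)
    (h : ∀ t ∈ Icc 0 T, φ t ≤ L * ∫ τ in (0 : ℝ)..t, smoothBound (t - τ) * φ τ) :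
    ∀ t ∈ Icc 0 T, φ t = 0 := by
  intro t ht
  have hT : 0 ≤ T := ht.1.trans ht.2
  -- The mass `(L + 1)⁻¹` makes `L` times it less than one, which forces the maximum `m` of the
  -- weighted function to vanish.
  obtain ⟨c, hc⟩ := exists_integral_smoothBound_mul_exp_lt hT
    (show (0 : ℝ) < (L + 1)⁻¹ by positivity)
  have hψ : Continuous fun t ↦ φ t * Real.exp (-(c * t)) := by fun_prop
  obtain ⟨t₀, ht₀, hmax⟩ := isCompact_Icc.exists_isMaxOn ⟨t, ht⟩ hψ.continuousOn
  set m := φ t₀ * Real.exp (-(c * t₀)) with hm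
  have hm0 : 0 ≤ m := mul_nonneg (hφ0 _) (Real.exp_pos _).le
  have hle : ∀ τ ∈ Icc 0 T, φ τ * Real.exp (-(c * τ)) ≤ m := fun τ hτ ↦ hmax hτ
  have hexp : Continuous fun σ : ℝ ↦ Real.exp (-(c * σ)) := by fun_prop
  have hi : ∀ a b, IntervalIntegrable (fun σ ↦ smoothBound σ * Real.exp (-(c * σ))) volume a b :=
    fun a b ↦ (intervalIntegrable_smoothBound a b).mul_continuousOn hexp.continuousOn
  have h1 : ∫ τ in (0 : ℝ)..t₀, smoothBound (t₀ - τ) * φ τ ≤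
      ∫ τ in (0 : ℝ)..t₀, smoothBound (t₀ - τ) * (m * Real.exp (c * τ)) := by
    refine intervalIntegral.integral_mono_on ht₀.1 (intervalIntegrable_smoothBound_sub_mul hφ t₀)
      (intervalIntegrable_smoothBound_sub_mul (by fun_prop) t₀) fun τ hτ ↦ ?_
    refine mul_le_mul_of_nonneg_left ?_ (smoothBound_nonneg (sub_nonneg.2 hτ.2))
    have h2 := hle τ ⟨hτ.1, hτ.2.trans ht₀.2⟩
    rwa [Real.exp_neg, ← div_eq_mul_inv, div_le_iff₀ (Real.exp_pos _)] at h2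
  have h2 : ∫ τ in (0 : ℝ)..t₀, smoothBound (t₀ - τ) * (m * Real.exp (c * τ)) =
      m * Real.exp (c * t₀) * ∫ σ in (0 : ℝ)..t₀, smoothBound σ * Real.exp (-(c * σ)) := by
    have h3 := intervalIntegral.integral_comp_sub_left (a := 0) (b := t₀)
        (fun σ ↦ smoothBound σ * Real.exp (-(c * σ))) t₀
    rw [sub_self, sub_zero] at h3
    rw [← h3, ← intervalIntegral.integral_const_mul]
    refine intervalIntegral.integral_congr fun τ _ ↦ ?_
    rw [show c * τ = c * t₀ + -(c * (t₀ - τ)) by ring, Real.exp_add]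
    ring
  have h3 : ∫ σ in (0 : ℝ)..t₀, smoothBound σ * Real.exp (-(c * σ)) ≤
      ∫ σ in (0 : ℝ)..T, smoothBound σ * Real.exp (-(c * σ)) := by
    refine intervalIntegral.integral_mono_interval le_rfl ht₀.1 ht₀.2 ?_ (hi 0 T)
    refine (ae_restrict_iff' measurableSet_Ioc).2 (.of_forall fun σ hσ ↦ ?_)
    exact mul_nonneg (smoothBound_nonneg hσ.1.le) (Real.exp_pos _).le
  have h4 : m ≤ L * (m * (L + 1)⁻¹) := by
    calc m ≤ (L * (m * Real.exp (c * t₀) *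
          ∫ σ in (0 : ℝ)..t₀, smoothBound σ * Real.exp (-(c * σ)))) * Real.exp (-(c * t₀)) := by
          rw [← h2]
          exact mul_le_mul_of_nonneg_right ((h t₀ ht₀).trans (mul_le_mul_of_nonneg_left h1 hL))
            (Real.exp_pos _).le
      _ = L * (m * ∫ σ in (0 : ℝ)..t₀, smoothBound σ * Real.exp (-(c * σ))) *
            (Real.exp (c * t₀) * Real.exp (-(c * t₀))) := by ring
      _ = L * (m * ∫ σ in (0 : ℝ)..t₀, smoothBound σ * Real.exp (-(c * σ))) := by
          rw [← Real.exp_add, add_neg_cancel, Real.exp_zero, mul_one]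
      _ ≤ _ := by gcongr; exact h3.trans hc.le
  have h5 : m = 0 := by
    have h6 : L * (m * (L + 1)⁻¹) = m - m * (L + 1)⁻¹ := by field_simp; ring
    have h7 : 0 < (L + 1)⁻¹ := by positivity
    nlinarith
  have h6 := hle t ht
  rw [h5] at h6
  have h7 := Real.exp_pos (-(c * t))
  have h8 := hφ0 t
  nlinarith

end SingularGronwall

/-! ### Existence and uniqueness for an abstract quadratic nonlinearity. -/

section FixedPoint

variable {E : Type*} [NormedAddCommGroup E] [InnerProductSpace ℝ E] [FiniteDimensional ℝ E]
  [MeasurableSpace E] [BorelSpace E]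

/-- The estimates for a nonlinearity that is quadratic in `F` and linear in `B`. -/
structure IsQuadratic (Φ : Lp ℂ 2 (volume : Measure E) → Lp ℂ 2 (volume : Measure E) →
    Lp ℂ 2 (volume : Measure E)) (K : ℝ) : Prop where
  nonneg : 0 ≤ K
  continuous : Continuous (Function.uncurry Φ)
  norm_le : ∀ F B, ‖Φ F B‖ ≤ K * ‖F‖ ^ 2 * ‖B‖
  norm_sub_le : ∀ F F' B, ‖Φ F B - Φ F' B‖ ≤ K * (‖F‖ + ‖F'‖) * ‖F - F'‖ * ‖B‖

variable {Φ : Lp ℂ 2 (volume : Measure E) → Lp ℂ 2 (volume : Measure E) →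
    Lp ℂ 2 (volume : Measure E)} {K M : ℝ} {B : ℝ → Lp ℂ 2 (volume : Measure E)}

/-- Mild solutions are unique. -/
theorem mild_unique (hΦ : IsQuadratic Φ K) (hB : Continuous B) (hM : ∀ t, ‖B t‖ ≤ M)
    {U V : ℝ → Lp ℂ 2 (volume : Measure E)} (hU : Continuous U) (hV : Continuous V) {T : ℝ}
    (h0 : U 0 = V 0)
    (hUm : ∀ t ∈ Icc 0 T, U t = mulOp (heatSymbol t) (U 0) + duhamel (fun τ ↦ Φ (U τ) (B τ)) t)
    (hVm : ∀ t ∈ Icc 0 T, V t = mulOp (heatSymbol t) (V 0) + duhamel (fun τ ↦ Φ (V τ) (B τ)) t) :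
    EqOn U V (Icc 0 T) := by
  have hM0 : 0 ≤ M := (norm_nonneg _).trans (hM 0)
  obtain ⟨R, hR⟩ := isCompact_Icc.exists_bound_of_continuousOn (s := Icc 0 T)
    (hU.norm.add hV.norm).continuousOn
  have hNU : Continuous fun τ ↦ Φ (U τ) (B τ) := hΦ.continuous.comp (hU.prodMk hB)
  have hNV : Continuous fun τ ↦ Φ (V τ) (B τ) := hΦ.continuous.comp (hV.prodMk hB)
  have hφ : Continuous fun t ↦ ‖U t - V t‖ := (hU.sub hV).norm
  intro t ht
  have hR0 : 0 ≤ R := (norm_nonneg _).trans (hR t ht)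
  rw [← sub_eq_zero, ← norm_eq_zero]
  refine eq_zero_of_le_integral_smoothBound (L := K * R * M) hφ (fun t ↦ norm_nonneg _)
    (mul_nonneg (mul_nonneg hΦ.nonneg hR0) hM0) (fun t ht ↦ ?_) t ht
  have e : U t - V t = duhamel (fun τ ↦ Φ (U τ) (B τ) - Φ (V τ) (B τ)) t := by
    rw [duhamel_sub hNU hNV ht.1, hUm t ht, hVm t ht, h0]
    abel
  rw [e, ← intervalIntegral.integral_const_mul]
  refine (norm_duhamel_le (hNU.sub hNV) ht.1).trans ?_
  refine intervalIntegral.integral_mono_on ht.1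
    (intervalIntegrable_smoothBound_sub_mul (hNU.sub hNV).norm t)
    ((intervalIntegrable_smoothBound_sub_mul hφ t).const_mul _) fun τ hτ ↦ ?_
  have h1 : ‖Φ (U τ) (B τ) - Φ (V τ) (B τ)‖ ≤ K * R * M * ‖U τ - V τ‖ := by
    have h2 : ‖U τ‖ + ‖V τ‖ ≤ R := (le_abs_self _).trans (hR τ ⟨hτ.1, hτ.2.trans ht.2⟩)
    calc _ ≤ K * (‖U τ‖ + ‖V τ‖) * ‖U τ - V τ‖ * ‖B τ‖ := hΦ.norm_sub_le _ _ _
      _ ≤ K * R * ‖U τ - V τ‖ * M := by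
        have := hΦ.nonneg
        gcongr
        exact hM τ
      _ = _ := by ring
  calc _ ≤ smoothBound (t - τ) * (K * R * M * ‖U τ - V τ‖) :=
        mul_le_mul_of_nonneg_left h1 (smoothBound_nonneg (sub_nonneg.2 hτ.2))
    _ = _ := by ring

theorem exists_time_small (L : ℝ) : ∃ T : ℝ, 0 < T ∧ (T + 2 * T ^ (1 / 2 : ℝ)) * L ≤ 1 / 2 := by
  have hc : Continuous fun T : ℝ ↦ (T + 2 * T ^ (1 / 2 : ℝ)) * L := by
    have : Continuous fun T : ℝ ↦ T ^ (1 / 2 : ℝ) :=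
      continuous_id.rpow_const fun _ ↦ Or.inr (by norm_num)
    fun_prop
  have h0 : Tendsto (fun T : ℝ ↦ (T + 2 * T ^ (1 / 2 : ℝ)) * L) (𝓝[>] 0) (𝓝 0) := by
    have := (hc.tendsto 0).mono_left (nhdsWithin_le_nhds (s := Ioi 0))
    simpa using this
  obtain ⟨T, h1, h2⟩ := ((h0.eventually (gt_mem_nhds (show (0 : ℝ) < 1 / 2 by norm_num))).and
    self_mem_nhdsWithin).exists
  exact ⟨T, h2, h1.le⟩

/-- Local existence of mild solutions within a closed set `W`. -/
theorem exists_mild (hΦ : IsQuadratic Φ K) (hB : Continuous B) (hM : ∀ t, ‖B t‖ ≤ M)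
    {W : Set (Lp ℂ 2 (volume : Measure E))} (hW : IsClosed W)
    {U₀ : Lp ℂ 2 (volume : Measure E)} (hU₀ : U₀ ∈ W)
    (hinv : ∀ U : ℝ → Lp ℂ 2 (volume : Measure E), Continuous U → (∀ t, U t ∈ W) →
      ∀ t, 0 ≤ t → mulOp (heatSymbol t) U₀ + duhamel (fun τ ↦ Φ (U τ) (B τ)) t ∈ W) :
    ∃ T : ℝ, 0 < T ∧ ∃ U : ℝ → Lp ℂ 2 (volume : Measure E), Continuous U ∧ (∀ t, U t ∈ W) ∧
      U 0 = U₀ ∧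
      ∀ t ∈ Icc 0 T, U t = mulOp (heatSymbol t) (U 0) + duhamel (fun τ ↦ Φ (U τ) (B τ)) t := by
  have hM0 : 0 ≤ M := (norm_nonneg _).trans (hM 0)
  have hK := hΦ.nonneg
  set R := ‖U₀‖ + 1 with hR
  have hR1 : 1 ≤ R := by rw [hR]; linarith [norm_nonneg U₀]
  -- Since `R ≥ 1`, this constant dominates both the size `K R² M` of the nonlinearity on the ball
  -- and its Lipschitz constant `2 K R M`. A Duhamel term of norm at most `1/2` fits inside the
  -- margin `R - ‖U₀‖ = 1`.
  obtain ⟨T, hT, hsmall⟩ := exists_time_small (2 * K * R ^ 2 * M)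
  set κ := T + 2 * T ^ (1 / 2 : ℝ) with hκ
  have hκ0 : 0 ≤ κ := by positivity
  let ext : C(Icc 0 T, Lp ℂ 2 (volume : Measure E)) → ℝ → Lp ℂ 2 (volume : Measure E) :=
    fun U ↦ IccExtend hT.le U
  have hext : ∀ U, Continuous (ext U) := fun U ↦ U.continuous.Icc_extend'
  have hN : ∀ U, Continuous fun τ ↦ Φ (ext U τ) (B τ) :=
    fun U ↦ hΦ.continuous.comp ((hext U).prodMk hB)
  have hNb : ∀ U τ, ‖Φ (ext U τ) (B τ)‖ ≤ K * ‖U‖ ^ 2 * M := fun U τ ↦ by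
    refine (hΦ.norm_le _ _).trans ?_
    have : ‖ext U τ‖ ≤ ‖U‖ := U.norm_coe_le_norm _
    gcongr
    exact hM τ
  have hcont : ∀ U, ContinuousOn (fun t ↦ mulOp (heatSymbol t) U₀ +
      duhamel (fun τ ↦ Φ (ext U τ) (B τ)) t) (Icc 0 T) := fun U ↦
    ((continuousOn_mulOp_heatSymbol U₀).mono Icc_subset_Ici_self).add
      (continuousOn_duhamel (hN U) (hNb U) T)
  let Ψ : C(Icc 0 T, Lp ℂ 2 (volume : Measure E)) → C(Icc 0 T, Lp ℂ 2 (volume : Measure E)) :=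
    fun U ↦ ⟨_, continuousOn_iff_continuous_domRestrict.1 (hcont U)⟩
  have hΨ : ∀ U (t : Icc 0 T), Ψ U t = mulOp (heatSymbol t) U₀ +
      duhamel (fun τ ↦ Φ (ext U τ) (B τ)) t := fun U t ↦ rfl
  let S : Set C(Icc 0 T, Lp ℂ 2 (volume : Measure E)) := {U | ‖U‖ ≤ R ∧ ∀ t, U t ∈ W}
  have hS : IsClosed S := by
    refine (isClosed_le continuous_norm continuous_const).inter ?_
    have : {U : C(Icc 0 T, Lp ℂ 2 (volume : Measure E)) | ∀ t, U t ∈ W} =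
        ⋂ t, {U | U t ∈ W} := by ext; simp
    change IsClosed {U : C(Icc 0 T, Lp ℂ 2 (volume : Measure E)) | ∀ t, U t ∈ W}
    rw [this]
    exact isClosed_iInter fun t ↦ hW.preimage (continuous_eval_const t)
  have hmaps : MapsTo Ψ S S := by
    intro U hU
    refine ⟨(ContinuousMap.norm_le _ (by linarith)).2 fun t ↦ ?_, fun t ↦ ?_⟩
    · rw [hΨ]
      refine (norm_add_le _ _).trans ?_
      have h1 := norm_mulOp_heatSymbol_le t.2.1 U₀
      have h2 := norm_duhamel_le_of_le (hN U) t.2.1 t.2.2 (hNb U)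
      have h3 : K * ‖U‖ ^ 2 * M ≤ 2 * K * R ^ 2 * M := by
        have := hU.1
        calc K * ‖U‖ ^ 2 * M ≤ K * R ^ 2 * M := by gcongr
          _ ≤ 2 * (K * R ^ 2 * M) := by
            have : 0 ≤ K * R ^ 2 * M := by positivity
            linarith
          _ = _ := by ring
      have h4 := mul_le_mul_of_nonneg_left h3 hκ0
      linarith
    · rw [hΨ]
      exact hinv (ext U) (hext U) (fun τ ↦ hU.2 _) t t.2.1
  have hlip : ContractingWith (1 / 2) (hmaps.restrict Ψ S S) := by
    refine ⟨by rw [← NNReal.coe_lt_coe]; norm_num, LipschitzWith.of_dist_le_mul fun U V ↦ ?_⟩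
    change dist (Ψ U) (Ψ V) ≤ _ * dist (U : C(Icc 0 T, Lp ℂ 2 (volume : Measure E))) V
    refine (ContinuousMap.dist_le (by positivity)).2 fun t ↦ ?_
    rw [hΨ, hΨ, dist_add_left, dist_eq_norm, ← duhamel_sub (hN _) (hN _) t.2.1]
    have h1 : ∀ τ, ‖Φ (ext U τ) (B τ) - Φ (ext V τ) (B τ)‖ ≤
        2 * K * R ^ 2 * M * dist (U : C(Icc 0 T, Lp ℂ 2 (volume : Measure E))) V := by
      intro τ
      have hu : ‖ext U τ‖ ≤ R := (ContinuousMap.norm_coe_le_norm _ _).trans U.2.1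
      have hv : ‖ext V τ‖ ≤ R := (ContinuousMap.norm_coe_le_norm _ _).trans V.2.1
      have hd : ‖ext U τ - ext V τ‖ ≤
          dist (U : C(Icc 0 T, Lp ℂ 2 (volume : Measure E))) V := by
        rw [← dist_eq_norm]
        exact ContinuousMap.dist_apply_le_dist _
      calc _ ≤ K * (‖ext U τ‖ + ‖ext V τ‖) * ‖ext U τ - ext V τ‖ * ‖B τ‖ :=
            hΦ.norm_sub_le _ _ _
        _ ≤ K * (R + R) * dist (U : C(Icc 0 T, Lp ℂ 2 (volume : Measure E))) V * M := by
            gcongr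
            exact hM τ
        _ = 2 * K * R * M * dist (U : C(Icc 0 T, Lp ℂ 2 (volume : Measure E))) V := by ring
        _ ≤ _ := by
            have : R ≤ R ^ 2 := by nlinarith
            gcongr
    refine (norm_duhamel_le_of_le ((hN _).sub (hN _)) t.2.1 t.2.2 h1).trans ?_
    rw [← mul_assoc]
    gcongr
    simpa [hκ] using hsmall
  have hmem : ContinuousMap.const (Icc 0 T) U₀ ∈ S :=
    ⟨(ContinuousMap.norm_le _ (by linarith)).2 fun t ↦ by
      simp only [ContinuousMap.const_apply]; linarith, fun t ↦ hU₀⟩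
  obtain ⟨U, hUS, hUfix, -⟩ := hlip.exists_fixedPoint' hS.isComplete hmaps hmem (edist_ne_top _ _)
  have hU : ∀ t ∈ Icc 0 T, ext U t = mulOp (heatSymbol t) U₀ +
      duhamel (fun τ ↦ Φ (ext U τ) (B τ)) t := by
    intro t ht
    have h1 : ext U t = U ⟨t, ht⟩ := IccExtend_of_mem _ _ ht
    rw [h1]
    conv_lhs => rw [← hUfix.eq]
    rw [hΨ]
  have hU0 : ext U 0 = U₀ := by
    rw [hU 0 ⟨le_rfl, hT.le⟩, duhamel, intervalIntegral.integral_same, add_zero]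
    have : (heatSymbol 0 : E → ℂ) = fun _ ↦ 1 := by ext ξ; exact heatSymbol_zero ξ
    rw [this, mulOp_one, ContinuousLinearMap.id_apply]
  exact ⟨T, hT, ext U, hext U, fun t ↦ hUS.2 _, hU0, by rwa [hU0]⟩

end FixedPoint

/-! ### The nonlinear term in symbols. -/

section Nonlinearity

variable {n : ℕ} {s : ℝ}

/-- The nonlinear term `|∇u|² b` in terms of symbols, for a product `P` of symbols. -/
def quadTerm (n : ℕ) (P : Lp ℂ 2 (volume : Measure (EuclideanSpace ℝ (Fin n))) →L[ℂ]
      Lp ℂ 2 (volume : Measure (EuclideanSpace ℝ (Fin n))) →L[ℂ]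
      Lp ℂ 2 (volume : Measure (EuclideanSpace ℝ (Fin n))))
    (F B : Lp ℂ 2 (volume : Measure (EuclideanSpace ℝ (Fin n)))) :
    Lp ℂ 2 (volume : Measure (EuclideanSpace ℝ (Fin n))) :=
  ∑ i, P (P (mulOp (gradSymbol (EuclideanSpace.basisFun (Fin n) ℝ i)) F)
    (mulOp (gradSymbol (EuclideanSpace.basisFun (Fin n) ℝ i)) F)) B

/-- The telescoping `P a a - P a' a' = P a (a - a') + P (a - a') a'`, which needs no symmetry of
`P`. -/
theorem norm_quad_sub_le {X : Type*} [NormedAddCommGroup X] [NormedSpace ℂ X]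
    (P : X →L[ℂ] X →L[ℂ] X) (D : X →L[ℂ] X) (F F' B : X) :
    ‖P (P (D F) (D F)) B - P (P (D F') (D F')) B‖ ≤
      ‖P‖ ^ 2 * ‖D‖ ^ 2 * (‖F‖ + ‖F'‖) * ‖F - F'‖ * ‖B‖ := by
  have e : P (P (D F) (D F)) B - P (P (D F') (D F')) B =
      P (P (D F) (D (F - F')) + P (D (F - F')) (D F')) B := by
    simp only [map_sub, map_add, sub_apply, add_apply]
    abel
  have h : ∀ a b, ‖P (D a) (D b)‖ ≤ ‖P‖ * (‖D‖ * ‖a‖) * (‖D‖ * ‖b‖) := fun a b ↦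
    (P.le_opNorm₂ _ _).trans (by gcongr <;> exact D.le_opNorm _)
  rw [e]
  calc _ ≤ ‖P‖ * ‖P (D F) (D (F - F')) + P (D (F - F')) (D F')‖ * ‖B‖ := P.le_opNorm₂ _ _
    _ ≤ ‖P‖ * (‖P‖ * (‖D‖ * ‖F‖) * (‖D‖ * ‖F - F'‖) +
          ‖P‖ * (‖D‖ * ‖F - F'‖) * (‖D‖ * ‖F'‖)) * ‖B‖ := by
        gcongr
        exact (norm_add_le _ _).trans (add_le_add (h _ _) (h _ _))
    _ = _ := by ring

theorem exists_isQuadratic_quadTerm (P : Lp ℂ 2 (volume : Measure (EuclideanSpace ℝ (Fin n))) →L[ℂ]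
      Lp ℂ 2 (volume : Measure (EuclideanSpace ℝ (Fin n))) →L[ℂ]
      Lp ℂ 2 (volume : Measure (EuclideanSpace ℝ (Fin n)))) :
    ∃ K, IsQuadratic (quadTerm n P) K := by
  set D := fun i ↦ mulOp (gradSymbol (EuclideanSpace.basisFun (Fin n) ℝ i))
  have key : ∀ F F' B, ‖quadTerm n P F B - quadTerm n P F' B‖ ≤
      (∑ i, ‖P‖ ^ 2 * ‖D i‖ ^ 2) * (‖F‖ + ‖F'‖) * ‖F - F'‖ * ‖B‖ := by
    intro F F' B
    rw [quadTerm, quadTerm, ← Finset.sum_sub_distrib, Finset.sum_mul, Finset.sum_mul,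
      Finset.sum_mul]
    exact norm_sum_le_of_le _ fun i _ ↦ norm_quad_sub_le P (D i) F F' B
  refine ⟨∑ i, ‖P‖ ^ 2 * ‖D i‖ ^ 2, by positivity, ?_, fun F B ↦ ?_, key⟩
  · unfold quadTerm Function.uncurry
    refine continuous_finsetSum _ fun i _ ↦ ?_
    have h1 : Continuous fun p : Lp ℂ 2 (volume : Measure (EuclideanSpace ℝ (Fin n))) ×
        Lp ℂ 2 (volume : Measure (EuclideanSpace ℝ (Fin n))) ↦ D i p.1 :=
      (D i).continuous.comp continuous_fst
    exact (P.continuous.comp ((P.continuous.comp h1).clm_apply h1)).clm_apply continuous_snd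
  · have h := key F 0 B
    have h0 : quadTerm n P 0 B = 0 := by simp [quadTerm]
    rw [h0, sub_zero, sub_zero, norm_zero, add_zero] at h
    refine h.trans (le_of_eq ?_)
    ring

end Nonlinearity

/-! ### Pointwise meaning of the symbol operations. -/

section Pointwise

variable {n : ℕ} {s : ℝ}

namespace HSob

theorem differentiableAt_rep (hs : (n : ℝ) < 2 * (s - 1)) (u : HSob n s)
    (x : EuclideanSpace ℝ (Fin n)) : DifferentiableAt ℝ u.rep x := by
  have h := contDiff_synth 1 (r := s) (by simpa using hs) (symbol u)
  have h1 : u.rep = fun x ↦ (synth s (symbol u) x).re := by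
    ext x; rw [synth_symbol (by linarith), Complex.ofReal_re]
  rw [h1]
  exact (Complex.reCLM.differentiableAt).comp x
    ((h.differentiable (by norm_num)).differentiableAt)

theorem contDiff_rep (hs : (n : ℝ) < 2 * (s - 2)) (u : HSob n s) : ContDiff ℝ 2 u.rep := by
  have h := contDiff_synth 2 (r := s) (by simpa using hs) (symbol u)
  have h1 : u.rep = fun x ↦ (synth s (symbol u) x).re := by
    ext x; rw [synth_symbol (by linarith), Complex.ofReal_re]
  rw [h1]
  exact Complex.reCLM.contDiff.comp h

theorem ofReal_fderiv_rep (hs : (n : ℝ) < 2 * (s - 1)) (u : HSob n s)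
    (x v : EuclideanSpace ℝ (Fin n)) :
    ((fderiv ℝ u.rep x v : ℝ) : ℂ) = synth (s - 1) (mulOp (gradSymbol v) (symbol u)) x := by
  rw [← fderiv_synth_apply (by simpa using hs)]
  have h1 : synth s (symbol u) = Complex.ofRealCLM ∘ u.rep := by
    ext x; exact synth_symbol (by linarith) u x
  rw [h1, (Complex.ofRealCLM.hasFDerivAt.comp x (differentiableAt_rep hs u x).hasFDerivAt).fderiv]
  rfl

theorem ofReal_norm_gradient_sq (hs : (n : ℝ) < 2 * (s - 1)) (u : HSob n s)
    (x : EuclideanSpace ℝ (Fin n)) :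
    ((‖∇ u.rep x‖ ^ 2 : ℝ) : ℂ) = ∑ i, synth (s - 1)
      (mulOp (gradSymbol (EuclideanSpace.basisFun (Fin n) ℝ i)) (symbol u)) x ^ 2 := by
  rw [← (EuclideanSpace.basisFun (Fin n) ℝ).sum_sq_inner_left, Complex.ofReal_sum]
  refine Finset.sum_congr rfl fun i _ ↦ ?_
  rw [← ofReal_fderiv_rep hs, ← Complex.ofReal_pow]
  congr 2
  rw [gradient, InnerProductSpace.toDual_symm_apply]

theorem ofReal_laplacian_rep (hs : (n : ℝ) < 2 * (s - 2)) (u : HSob n s)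
    (x : EuclideanSpace ℝ (Fin n)) :
    ((Δ u.rep x : ℝ) : ℂ) = synth (s - 2) (mulOp laplaceSymbol (symbol u)) x := by
  have hs2 : (finrank ℝ (EuclideanSpace ℝ (Fin n)) : ℝ) < 2 * (s - 2) := by simpa using hs
  have hs1 : (n : ℝ) < 2 * (s - 1) := by linarith
  obtain ⟨L, hL⟩ := exists_synth_clm hs2 x
  set e := EuclideanSpace.basisFun (Fin n) ℝ
  have hsum : mulOp (laplaceSymbol : EuclideanSpace ℝ (Fin n) → ℂ) =
      ∑ i, mulOp (fun ξ ↦ gradSymbol (e i) ξ * gradSymbol (e i) ξ) := by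
    rw [← mulOp_finset_sum _ fun i ↦ memLp_top_mul (memLp_top_gradSymbol (e i))
      (memLp_top_gradSymbol (e i))]
    congr 1
    ext ξ
    rw [sum_gradSymbol_mul_gradSymbol]
  rw [← hL, hsum, sum_apply, map_sum,
    InnerProductSpace.laplacian_eq_iteratedFDeriv_orthonormalBasis u.rep e, Complex.ofReal_sum]
  refine Finset.sum_congr rfl fun i _ ↦ ?_
  rw [hL, iteratedFDeriv_two_apply]
  simp only [Matrix.cons_val_zero, Matrix.cons_val_one]
  rw [← mulOp_mulOp (memLp_top_gradSymbol (e i)) (memLp_top_gradSymbol (e i)) (fun ξ ↦ rfl),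
    show s - 2 = s - 1 - 1 by ring, ← fderiv_synth_apply (by simp only [finrank_euclideanSpace_fin]; linarith)]
  have h1 : synth (s - 1) (mulOp (gradSymbol (e i)) (symbol u)) =
      Complex.ofRealCLM ∘ fun y ↦ fderiv ℝ u.rep y (e i) := by
    ext y; exact (ofReal_fderiv_rep hs1 u y (e i)).symm
  have h2 : DifferentiableAt ℝ (fderiv ℝ u.rep) x :=
    (((contDiff_rep hs u).fderiv_right (m := 1) (by norm_num)).differentiable
      (by norm_num)).differentiableAt
  have h3 : HasFDerivAt (fun y ↦ fderiv ℝ u.rep y (e i))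
      ((ContinuousLinearMap.apply ℝ ℝ (e i)).comp (fderiv ℝ (fderiv ℝ u.rep) x)) x :=
    (ContinuousLinearMap.apply ℝ ℝ (e i)).hasFDerivAt.comp x h2.hasFDerivAt
  rw [h1, (Complex.ofRealCLM.hasFDerivAt.comp x h3).fderiv]
  rfl

theorem ofReal_rep_eq_synth_sub_two (hs : (n : ℝ) < 2 * s) (u : HSob n s)
    (x : EuclideanSpace ℝ (Fin n)) :
    (u.rep x : ℂ) = synth (s - 2) (mulOp (fun ξ ↦ (bracket (-2) ξ : ℂ)) (symbol u)) x := by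
  rw [synth_mulOp_eq_synth (r' := s) (memLp_top_bracket (by norm_num)), synth_symbol hs]
  intro ξ
  rw [← Complex.ofReal_mul, ← bracket_add]
  congr 2
  ring

end HSob

open HSob

variable {P : Lp ℂ 2 (volume : Measure (EuclideanSpace ℝ (Fin n))) →L[ℂ]
      Lp ℂ 2 (volume : Measure (EuclideanSpace ℝ (Fin n))) →L[ℂ]
      Lp ℂ 2 (volume : Measure (EuclideanSpace ℝ (Fin n)))}

theorem synth_quadTerm (hs : (n : ℝ) < 2 * (s - 1))
    (hP : ∀ F G x, synth (s - 1) (P F G) x = synth (s - 1) F x * synth (s - 1) G x)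
    (u : HSob n s) (b : HSob n (s - 1)) (x : EuclideanSpace ℝ (Fin n)) :
    synth (s - 1) (quadTerm n P (symbol u) (symbol b)) x = (nonlinearTerm u b x : ℝ) := by
  obtain ⟨L, hL⟩ := exists_synth_clm (E := EuclideanSpace ℝ (Fin n)) (r := s - 1)
    (by simpa using hs) x
  rw [nonlinearTerm, Complex.ofReal_mul, ofReal_norm_gradient_sq hs, ← hL, quadTerm, map_sum,
    Finset.sum_mul]
  refine Finset.sum_congr rfl fun i _ ↦ ?_
  rw [hL, hP, hP, synth_symbol hs, sq]

theorem ofReal_heatConv_rep {t : ℝ} (ht : 0 < t) (hs : (n : ℝ) < 2 * s) (u : HSob n s)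
    (x : EuclideanSpace ℝ (Fin n)) :
    (heatConv n t u.rep x : ℂ) = synth s (mulOp (heatSymbol t) (symbol u)) x :=
  ofReal_heatConv_eq_synth ht hs (synth_symbol hs u) x

/-- The heat flow acts at order `s - 1`; rewriting its output at order `s` costs one weight, which
is the factor built into `smoothSymbol`. -/
theorem ofReal_heatConv_nonlinearTerm {t : ℝ} (ht : 0 < t) (hs : (n : ℝ) < 2 * (s - 1))
    (hP : ∀ F G x, synth (s - 1) (P F G) x = synth (s - 1) F x * synth (s - 1) G x)
    (u : HSob n s) (b : HSob n (s - 1)) (x : EuclideanSpace ℝ (Fin n)) :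
    (heatConv n t (nonlinearTerm u b) x : ℂ) =
      synth s (mulOp (smoothSymbol t) (quadTerm n P (symbol u) (symbol b))) x := by
  rw [ofReal_heatConv_eq_synth ht hs (synth_quadTerm hs hP u b)]
  apply congrFun
  refine synth_mulOp (memLp_top_heatSymbol ht.le) (memLp_top_smoothSymbol ht) (fun ξ ↦ ?_) _
  rw [smoothSymbol, ← mul_assoc, ← Complex.ofReal_mul, ← bracket_add]
  congr 3
  ring

end Pointwise

/-! ### Both notions of solution as equations between symbols. -/

section Solutions

open HSob

variable {n : ℕ} {s : ℝ}
  {P : Lp ℂ 2 (volume : Measure (EuclideanSpace ℝ (Fin n))) →L[ℂ]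
      Lp ℂ 2 (volume : Measure (EuclideanSpace ℝ (Fin n))) →L[ℂ]
      Lp ℂ 2 (volume : Measure (EuclideanSpace ℝ (Fin n)))}
  {b : ℝ → HSob n (s - 1)} {u₀ : HSob n s} {T : ℝ} {v : ℝ → HSob n s}
  {V B : ℝ → Lp ℂ 2 (volume : Measure (EuclideanSpace ℝ (Fin n)))}

theorem continuous_quadTerm_comp (hV : Continuous V) (hB : Continuous B) :
    Continuous fun τ ↦ quadTerm n P (V τ) (B τ) := by
  obtain ⟨K, hK⟩ := exists_isQuadratic_quadTerm P
  exact hK.continuous.comp (hV.prodMk hB)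

/-- Evaluation at `x` is a continuous functional, so it commutes with the vector-valued Duhamel
integral and inherits its integrability. The endpoint `τ = t`, where the heat kernel degenerates, is
a null set. -/
theorem intervalIntegrable_heatConv_and_synth_duhamel (hs : (n : ℝ) < 2 * (s - 1))
    (hP : ∀ F G x, synth (s - 1) (P F G) x = synth (s - 1) F x * synth (s - 1) G x)
    (hV : Continuous V) (hB : Continuous B) {t : ℝ} (ht : 0 ≤ t)
    (hVv : ∀ τ ∈ Icc 0 t, V τ = symbol (v τ)) (hBb : ∀ τ ∈ Icc 0 t, B τ = symbol (b τ))
    (x : EuclideanSpace ℝ (Fin n)) :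
    IntervalIntegrable (fun τ ↦ heatConv n (t - τ) (nonlinearTerm (v τ) (b τ)) x) volume 0 t ∧
    synth s (duhamel (fun τ ↦ quadTerm n P (V τ) (B τ)) t) x =
      ((∫ τ in (0 : ℝ)..t, heatConv n (t - τ) (nonlinearTerm (v τ) (b τ)) x : ℝ) : ℂ) := by
  have hN : Continuous fun τ ↦ quadTerm n P (V τ) (B τ) := continuous_quadTerm_comp hV hB
  have hi := intervalIntegrable_smooth_integrand hN ht
  obtain ⟨L, hL⟩ := exists_synth_clm (E := EuclideanSpace ℝ (Fin n)) (r := s)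
    (by rw [finrank_euclideanSpace_fin]; linarith) x
  have hne : ∀ᵐ τ : ℝ, τ ≠ t := compl_mem_ae_iff.2 (measure_singleton t)
  have hae : ∀ᵐ τ : ℝ, τ ∈ uIoc 0 t →
      ((heatConv n (t - τ) (nonlinearTerm (v τ) (b τ)) x : ℝ) : ℂ) =
      L (mulOp (smoothSymbol (t - τ)) (quadTerm n P (V τ) (B τ))) := by
    filter_upwards [hne] with τ h1 h2
    rw [uIoc_of_le ht] at h2
    have h3 : τ ∈ Icc 0 t := Ioc_subset_Icc_self h2
    rw [ofReal_heatConv_nonlinearTerm (sub_pos.2 (lt_of_le_of_ne h2.2 h1)) hs hP, hL, hVv τ h3,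
      hBb τ h3]
  constructor
  · have h1 : IntervalIntegrable (fun τ ↦ (L (mulOp (smoothSymbol (t - τ))
        (quadTerm n P (V τ) (B τ)))).re) volume 0 t := by
      rw [intervalIntegrable_iff] at hi ⊢
      exact (L.integrable_comp hi).re
    refine h1.congr_ae ?_
    rw [EventuallyEq, ae_restrict_iff' measurableSet_uIoc]
    filter_upwards [hae] with τ h2 h3
    rw [← h2 h3, Complex.ofReal_re]
  · rw [← hL, duhamel, ← ContinuousLinearMap.intervalIntegral_comp_comm L hi,
      ← intervalIntegral.integral_ofReal]
    exact (intervalIntegral.integral_congr_ae hae).symm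

theorem exists_norm_rep_le (hs : (n : ℝ) < 2 * s) (u : HSob n s) :
    Continuous u.rep ∧ ∃ C, ∀ x, ‖u.rep x‖ ≤ C := by
  have h1 : u.rep = fun x ↦ (synth s (symbol u) x).re := by
    ext x; rw [synth_symbol hs, Complex.ofReal_re]
  obtain ⟨C, hC⟩ := exists_norm_synth_le s (symbol u)
  refine ⟨?_, C, fun x ↦ ?_⟩
  · rw [h1]
    exact Complex.continuous_re.comp (continuous_synth (by simpa using hs) _)
  · rw [← Complex.norm_real, ← synth_symbol hs]
    exact hC x

theorem exists_norm_nonlinearTerm_le (hs : (n : ℝ) < 2 * (s - 1))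
    (hP : ∀ F G x, synth (s - 1) (P F G) x = synth (s - 1) F x * synth (s - 1) G x)
    (u : HSob n s) (b : HSob n (s - 1)) :
    Continuous (nonlinearTerm u b) ∧ ∃ C, ∀ x, ‖nonlinearTerm u b x‖ ≤ C := by
  have h1 : nonlinearTerm u b =
      fun x ↦ (synth (s - 1) (quadTerm n P (symbol u) (symbol b)) x).re := by
    ext x; rw [synth_quadTerm hs hP, Complex.ofReal_re]
  obtain ⟨C, hC⟩ := exists_norm_synth_le (s - 1) (quadTerm n P (symbol u) (symbol b))
  refine ⟨?_, C, fun x ↦ ?_⟩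
  · rw [h1]
    exact Complex.continuous_re.comp (continuous_synth (by simpa using hs) _)
  · rw [← Complex.norm_real, ← synth_quadTerm hs hP]
    exact hC x

/-- Mild solutions in terms of symbols. -/
theorem isMildSolution_iff (hs : (n : ℝ) < 2 * (s - 1))
    (hP : ∀ F G x, synth (s - 1) (P F G) x = synth (s - 1) F x * synth (s - 1) G x)
    (hT : 0 < T) (hV : Continuous V) (hB : Continuous B) (h0 : v 0 = u₀)
    (hVv : ∀ τ ∈ Icc 0 T, V τ = symbol (v τ)) (hBb : ∀ τ ∈ Icc 0 T, B τ = symbol (b τ)) :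
    IsMildSolution b u₀ T v ↔ ∀ t ∈ Icc 0 T,
      V t = mulOp (heatSymbol t) (V 0) + duhamel (fun τ ↦ quadTerm n P (V τ) (B τ)) t := by
  have hs' : (n : ℝ) < 2 * s := by linarith
  have hsE : (finrank ℝ (EuclideanSpace ℝ (Fin n)) : ℝ) < 2 * s := by simpa using hs'
  have hV0 : V 0 = symbol u₀ := by rw [hVv 0 ⟨le_rfl, hT.le⟩, h0]
  have key : ∀ t ∈ Ioc 0 T, ∀ x,
      synth s (mulOp (heatSymbol t) (V 0) + duhamel (fun τ ↦ quadTerm n P (V τ) (B τ)) t) x =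
      ((heatConv n t u₀.rep x +
        ∫ τ in (0 : ℝ)..t, heatConv n (t - τ) (nonlinearTerm (v τ) (b τ)) x : ℝ) : ℂ) := by
    intro t ht x
    obtain ⟨L, hL⟩ := exists_synth_clm hsE x
    have h1 := (intervalIntegrable_heatConv_and_synth_duhamel hs hP hV hB ht.1.le
      (fun τ hτ ↦ hVv τ ⟨hτ.1, hτ.2.trans ht.2⟩) (fun τ hτ ↦ hBb τ ⟨hτ.1, hτ.2.trans ht.2⟩) x).2
    rw [← hL, map_add, hL, hL, h1, hV0, ← ofReal_heatConv_rep ht.1 hs', ← Complex.ofReal_add]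
  constructor
  · intro h t ht
    rcases ht.1.eq_or_lt with rfl | ht0
    · have : (heatSymbol 0 : EuclideanSpace ℝ (Fin n) → ℂ) = fun _ ↦ 1 := by
        ext ξ; exact heatSymbol_zero ξ
      rw [duhamel, intervalIntegral.integral_same, add_zero, this, mulOp_one,
        ContinuousLinearMap.id_apply]
    · refine synth_injective hsE fun x ↦ ?_
      rw [key t ⟨ht0, ht.2⟩, hVv t ht, synth_symbol hs', h.eqn t ⟨ht0, ht.2⟩ x]
  · intro h
    refine ⟨h0, fun t ht x ↦ ?_, fun t ht τ hτ x ↦ ?_, fun t ht x ↦ ?_, fun t ht x ↦ ?_⟩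
    · obtain ⟨hc, C, hC⟩ := exists_norm_rep_le hs' u₀
      exact integrable_heatKernel_mul ht.1 hc hC x
    · obtain ⟨hc, C, hC⟩ := exists_norm_nonlinearTerm_le hs hP (v τ) (b τ)
      exact integrable_heatKernel_mul (sub_pos.2 hτ.2) hc hC x
    · exact (intervalIntegrable_heatConv_and_synth_duhamel hs hP hV hB ht.1.le
        (fun τ hτ ↦ hVv τ ⟨hτ.1, hτ.2.trans ht.2⟩)
        (fun τ hτ ↦ hBb τ ⟨hτ.1, hτ.2.trans ht.2⟩) x).1
    · have ht' : t ∈ Icc 0 T := Ioc_subset_Icc_self ht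
      have h1 := key t ht x
      rw [← h t ht', hVv t ht', synth_symbol hs'] at h1
      exact_mod_cast h1

/-- Classical solutions in terms of symbols. -/
theorem isClassicalSolution_iff (hs : (n : ℝ) < 2 * (s - 2))
    (hP : ∀ F G x, synth (s - 1) (P F G) x = synth (s - 1) F x * synth (s - 1) G x)
    (hT : 0 < T) (hV : Continuous V) (hB : Continuous B) (h0 : v 0 = u₀)
    (hVv : ∀ τ ∈ Icc 0 T, V τ = symbol (v τ)) (hBb : ∀ τ ∈ Icc 0 T, B τ = symbol (b τ)) :
    IsClassicalSolution b u₀ T v ↔ ∀ t ∈ Icc 0 T,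
      mulOp (fun ξ ↦ (bracket (-2) ξ : ℂ)) (V t) =
      mulOp (fun ξ ↦ (bracket (-2) ξ : ℂ)) (V 0) + ∫ τ in (0 : ℝ)..t,
        (mulOp laplaceSymbol (V τ) +
          mulOp (fun ξ ↦ (bracket (-1) ξ : ℂ)) (quadTerm n P (V τ) (B τ))) := by
  have hsE : (finrank ℝ (EuclideanSpace ℝ (Fin n)) : ℝ) < 2 * (s - 2) := by simpa using hs
  have hg : Continuous fun τ ↦ mulOp laplaceSymbol (V τ) +
      mulOp (fun ξ ↦ (bracket (-1) ξ : ℂ)) (quadTerm n P (V τ) (B τ)) :=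
    ((mulOp _).continuous.comp hV).add
      ((mulOp _).continuous.comp (continuous_quadTerm_comp hV hB))
  have hrhs : ∀ t ∈ Icc 0 T, ∀ x, synth (s - 2) (mulOp laplaceSymbol (V t) +
      mulOp (fun ξ ↦ (bracket (-1) ξ : ℂ)) (quadTerm n P (V t) (B t))) x =
      ((Δ (v t).rep x + nonlinearTerm (v t) (b t) x : ℝ) : ℂ) := by
    intro t ht x
    obtain ⟨L, hL⟩ := exists_synth_clm hsE x
    rw [← hL, map_add, hL, hL, hVv t ht, hBb t ht, Complex.ofReal_add, ofReal_laplacian_rep hs,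
      ← synth_quadTerm (by linarith) hP]
    congr 1
    apply congrFun
    refine synth_mulOp_eq_synth (memLp_top_bracket (by norm_num)) (fun ξ ↦ ?_) _
    rw [← Complex.ofReal_mul, ← bracket_add]
    congr 2
    ring
  have hlhs : ∀ t ∈ Icc 0 T, ∀ x,
      synth (s - 2) (mulOp (fun ξ ↦ (bracket (-2) ξ : ℂ)) (V t)) x = ((v t).rep x : ℂ) :=
    fun t ht x ↦ by rw [hVv t ht, ofReal_rep_eq_synth_sub_two (by linarith)]
  have hmem0 : (0 : ℝ) ∈ Icc 0 T := ⟨le_rfl, hT.le⟩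
  constructor
  · intro h t ht
    refine synth_injective hsE fun x ↦ ?_
    obtain ⟨L, hL⟩ := exists_synth_clm hsE x
    have hsub : Icc 0 t ⊆ Icc 0 T := Icc_subset_Icc_right ht.2
    have hd : ∀ τ ∈ Icc 0 T, HasDerivWithinAt (fun τ ↦ ((v τ).rep x : ℂ))
        (L (mulOp laplaceSymbol (V τ) +
          mulOp (fun ξ ↦ (bracket (-1) ξ : ℂ)) (quadTerm n P (V τ) (B τ)))) (Icc 0 T) τ := by
      intro τ hτ
      rw [hL, hrhs τ hτ]
      exact Complex.ofRealCLM.hasFDerivAt.comp_hasDerivWithinAt τ (h.eqn τ hτ x)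
    have hint := intervalIntegral.integral_eq_sub_of_hasDerivAt_of_le ht.1
      (fun τ hτ ↦ ((hd τ (hsub hτ)).continuousWithinAt.mono hsub))
      (fun τ hτ ↦ (hd τ (hsub (Ioo_subset_Icc_self hτ))).hasDerivAt
        (Icc_mem_nhds hτ.1 (hτ.2.trans_le ht.2)))
      ((L.continuous.comp hg).intervalIntegrable 0 t)
    -- The scalar identity at `x` becomes the evaluation of an `L²`-valued integral; since `x` is
    -- arbitrary, `synth_injective` lifts it to symbols.
    rw [ContinuousLinearMap.intervalIntegral_comp_comm L (hg.intervalIntegrable 0 t)] at hint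
    rw [← hL, ← hL, map_add, hint, hL, hL, hlhs t ht, hlhs 0 hmem0]
    ring
  · intro h
    refine ⟨h0, fun t _ ↦ contDiff_rep hs (v t), fun t ht x ↦ ?_⟩
    obtain ⟨L, hL⟩ := exists_synth_clm hsE x
    have h1 := ((hg.integral_hasStrictDerivAt 0 t).hasDerivAt.const_add
      (mulOp (fun ξ ↦ (bracket (-2) ξ : ℂ)) (V 0)))
    have h2 := (L.restrictScalars ℝ).hasFDerivAt.comp_hasDerivAt t h1
    have h3 := (Complex.reCLM.hasFDerivAt.comp_hasDerivAt t h2).hasDerivWithinAt (s := Icc 0 T)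
    have e1 : ∀ τ ∈ Icc 0 T, (v τ).rep x = (L (mulOp (fun ξ ↦ (bracket (-2) ξ : ℂ)) (V 0) +
        ∫ τ in (0 : ℝ)..τ, (mulOp laplaceSymbol (V τ) +
          mulOp (fun ξ ↦ (bracket (-1) ξ : ℂ)) (quadTerm n P (V τ) (B τ))))).re := by
      intro τ hτ
      rw [← h τ hτ, hL, hlhs τ hτ, Complex.ofReal_re]
    have e2 : Δ (v t).rep x + nonlinearTerm (v t) (b t) x = (L (mulOp laplaceSymbol (V t) +
          mulOp (fun ξ ↦ (bracket (-1) ξ : ℂ)) (quadTerm n P (V t) (B t)))).re := by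
      rw [hL, hrhs t ht, Complex.ofReal_re]
    rw [e2]
    exact h3.congr e1 (e1 t ht)

/-- An intersection over `x` of zero sets of continuous functionals. It serves as the set `W` of
`exists_mild`, keeping the iteration within real-valued functions. -/
theorem isClosed_setOf_synth_im_eq_zero (hs : (n : ℝ) < 2 * s) :
    IsClosed {F : Lp ℂ 2 (volume : Measure (EuclideanSpace ℝ (Fin n))) |
      ∀ x, (synth s F x).im = 0} := by
  have hsE : (finrank ℝ (EuclideanSpace ℝ (Fin n)) : ℝ) < 2 * s := by simpa using hs
  have : {F : Lp ℂ 2 (volume : Measure (EuclideanSpace ℝ (Fin n))) |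
      ∀ x, (synth s F x).im = 0} = ⋂ x, {F | (synth s F x).im = 0} := by ext; simp
  rw [this]
  refine isClosed_iInter fun x ↦ ?_
  obtain ⟨L, hL⟩ := exists_synth_clm hsE x
  simp_rw [← hL]
  exact isClosed_eq (Complex.continuous_im.comp L.continuous) continuous_const

end Solutions

end

/-! ### Assembly of the main theorem. -/

theorem proposition1 (n : ℕ) (hn : 1 ≤ n) (s : ℝ) (hs : (n : ℝ) / 2 + 3 < s)
    (u₀ : HSob n s) (b : ℝ → HSob n (s - 1))
    (hb_cont : ContinuousOn b (Set.Ici 0))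
    (hb_bdd : ∃ M : ℝ, ∀ t ∈ Set.Ici (0 : ℝ), ‖b t‖ ≤ M) :
    ∃ T₀ : ℝ, 0 < T₀ ∧ ∃ u : ℝ → HSob n s,
      ContinuousOn u (Set.Icc 0 T₀) ∧
      IsClassicalSolution b u₀ T₀ u ∧
      IsMildSolution b u₀ T₀ u ∧
      ∀ v : ℝ → HSob n s, ContinuousOn v (Set.Icc 0 T₀) →
        (IsClassicalSolution b u₀ T₀ v ∨ IsMildSolution b u₀ T₀ v) →
        Set.EqOn v u (Set.Icc 0 T₀) := by
  have hs0 : (n : ℝ) < 2 * s := by linarith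
  have hs1 : (n : ℝ) < 2 * (s - 1) := by linarith
  have hs2 : (n : ℝ) < 2 * (s - 2) := by linarith
  have hsE : (Module.finrank ℝ (EuclideanSpace ℝ (Fin n)) : ℝ) < 2 * s := by simpa using hs0
  obtain ⟨P, hP⟩ := exists_mul_clm (E := EuclideanSpace ℝ (Fin n)) (r := s - 1) (by simpa using hs1)
  obtain ⟨K, hK⟩ := exists_isQuadratic_quadTerm P
  obtain ⟨M, hM⟩ := hb_bdd
  -- Freezing `b` at its initial value for negative times makes the coefficient continuous and
  -- bounded on the whole line.
  set B : ℝ → Lp ℂ 2 (volume : Measure (EuclideanSpace ℝ (Fin n))) :=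
    fun t ↦ HSob.symbol (b (max t 0)) with hB_def
  have hB : Continuous B := HSob.symbol.continuous.comp
    (hb_cont.comp_continuous (by fun_prop) fun t ↦ mem_Ici.2 (le_max_right _ _))
  have hBM : ∀ t, ‖B t‖ ≤ M := fun t ↦ by
    rw [hB_def, LinearIsometry.norm_map]
    exact hM _ (mem_Ici.2 (le_max_right _ _))
  have hBb : ∀ t, 0 ≤ t → B t = HSob.symbol (b t) := fun t ht ↦ by simp only [hB_def, max_eq_left ht]
  obtain ⟨T, hT, U, hU, hUW, hU0, hUm⟩ := exists_mild (U₀ := HSob.symbol u₀) hK hB hBM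
    (isClosed_setOf_synth_im_eq_zero hs0)
    (fun x ↦ by rw [HSob.synth_symbol hs0, Complex.ofReal_im]) (by
      intro U hU hUW t ht x
      -- A real-valued curve of symbols comes from actual Sobolev functions, so its Duhamel term
      -- evaluates to an integral of real heat convolutions.
      choose u hu using fun τ ↦ HSob.exists_symbol_eq hs0 (hUW τ)
      obtain ⟨L, hL⟩ := exists_synth_clm hsE x
      rw [← hL, map_add, hL, hL, (intervalIntegrable_heatConv_and_synth_duhamel hs1 hP hU hB ht
        (fun τ _ ↦ (hu τ).symm) (fun τ hτ ↦ hBb τ hτ.1) x).2, Complex.add_im, Complex.ofReal_im,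
        add_zero]
      rcases ht.eq_or_lt with rfl | ht0
      · have : (heatSymbol 0 : EuclideanSpace ℝ (Fin n) → ℂ) = fun _ ↦ 1 := by
          ext ξ; exact heatSymbol_zero ξ
        rw [this, mulOp_one, ContinuousLinearMap.id_apply, HSob.synth_symbol hs0, Complex.ofReal_im]
      · rw [← ofReal_heatConv_rep ht0 hs0, Complex.ofReal_im])
  choose u hu using fun τ ↦ HSob.exists_symbol_eq hs0 (hUW τ)
  have hucont : Continuous u := by
    rw [← HSob.symbol.isometry.comp_continuous_iff]
    exact hU.congr fun t ↦ (hu t).symm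
  have hu0 : u 0 = u₀ := HSob.symbol.injective ((hu 0).trans hU0)
  have hBT : ∀ τ ∈ Icc 0 T, B τ = HSob.symbol (b τ) := fun τ hτ ↦ hBb τ hτ.1
  have hmild_iff := mild_iff_integrated hU (continuous_quadTerm_comp (P := P) hU hB) T
  refine ⟨T, hT, u, hucont.continuousOn, ?_, ?_, fun v hv hsol ↦ ?_⟩
  · exact (isClassicalSolution_iff hs2 hP hT hU hB hu0 (fun τ _ ↦ (hu τ).symm) hBT).2
      (hmild_iff.1 hUm)
  · exact (isMildSolution_iff hs1 hP hT hU hB hu0 (fun τ _ ↦ (hu τ).symm) hBT).2 hUm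
  -- The competitor is continuous only on `[0,T]`; clamping time to this interval gives a global
  -- continuous curve with the same symbols there.
  · obtain ⟨V, hV_def⟩ : ∃ V : ℝ → Lp ℂ 2 (volume : Measure (EuclideanSpace ℝ (Fin n))),
        ∀ t, V t = HSob.symbol (v (projIcc 0 T hT.le t)) := ⟨_, fun _ ↦ rfl⟩
    have hV : Continuous V := by
      rw [funext hV_def]
      exact HSob.symbol.continuous.comp (hv.comp_continuous
        (continuous_subtype_val.comp continuous_projIcc) fun t ↦ (projIcc 0 T hT.le t).2)
    have hVv : ∀ τ ∈ Icc 0 T, V τ = HSob.symbol (v τ) := fun τ hτ ↦ by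
      rw [hV_def, projIcc_of_mem hT.le hτ]
    have hv0 : v 0 = u₀ := hsol.elim (fun h ↦ h.init) (fun h ↦ h.init)
    have hVm : ∀ t ∈ Icc 0 T,
        V t = mulOp (heatSymbol t) (V 0) + duhamel (fun τ ↦ quadTerm n P (V τ) (B τ)) t := by
      rcases hsol with h | h
      · exact (mild_iff_integrated hV (continuous_quadTerm_comp hV hB) T).2
          ((isClassicalSolution_iff hs2 hP hT hV hB hv0 hVv hBT).1 h)
      · exact (isMildSolution_iff hs1 hP hT hV hB hv0 hVv hBT).1 h
    have hVU : V 0 = U 0 := by rw [hVv 0 ⟨le_rfl, hT.le⟩, hv0, hU0]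
    intro t ht
    apply HSob.symbol.injective
    rw [← hVv t ht, hu t]
    exact mild_unique hK hB hBM hV hU hVU hVm hUm ht
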